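/- Let $n \ge k \ge d$ be positive integers and let $\alpha = (\alpha_1,\dots,\alpha_k) \in \mathbb{Q}^k$ be a list of distinct rational numbers. Let $\mathcal{Z} = \mathcal{Z}_{n,k,d}(\alpha) \subseteq \mathbb{Q}^{n+d}$ be the set of points $(z_1,\dots,z_n;z_{n+1},\dots,z_{n+d})$ such that every $z_i$ lies in $\{\alpha_1,\dots,\alpha_k\}$, the coordinates $z_{n+1},\dots,z_{n+d}$ are distinct, and $\{z_1,\dots,z_n\} = \{z_{n+1},\dots,z_{n+d}\}$. Write $\mathbf{x} = (x_1,\dots,x_n)$, $\mathbf{y} = (y_1,\dots,y_d)$, and let $\mathbf{I}(\mathcal{Z}) \subseteq \mathbb{Q}[\mathbf{x},\mathbf{y}]$ be the ideal of polynomials vanishing on $\mathcal{Z}$. For an ideal $I$, let $\mathrm{gr}\, I$ be the ideal generated by the top degree homogeneous components of the nonzero elements of $I$. The symmetric group $\mathfrak{S}_d$ acts on $\mathbb{Q}[\mathbf{x},\mathbf{y}]$ by permuting $y_1,\dots,y_d$; this action preserves $\mathbf{I}(\mathcal{Z})$ and $\mathrm{gr}\,\mathbf{I}(\mathcal{Z})$.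 With $e_r$ and $h_r$ the elementary and complete homogeneous symmetric polynomials, let $J^{\mathbb{Q}}_{n,k,d} \subseteq \mathbb{Q}[\mathbf{x},\mathbf{y}]$ be the ideal generated by - $h_r(\mathbf{y})$ for all $r > k-d$, - $\sum_{b=0}^{r} (-1)^b e_{r-b}(\mathbf{x})\, h_b(\mathbf{y})$ for all $r > n-d$, and - $\sum_{b=0}^{d} (-1)^b x_i^{d-b} e_b(\mathbf{y})$ for $i = 1,\dots,n$. Then: 1. $\mathrm{gr}\,\mathbf{I}(\mathcal{Z}) = J^{\mathbb{Q}}_{n,k,d}$ as ideals of $\mathbb{Q}[\mathbf{x},\mathbf{y}]$. 2. $\mathbb{Q}[\mathcal{Z}] = \mathbb{Q}[\mathbf{x},\mathbf{y}]/\mathbf{I}(\mathcal{Z})$ and $\mathbb{Q}[\mathbf{x},\mathbf{y}]/\mathrm{gr}\,\mathbf{I}(\mathcal{Z})$ are isomorphic as $\mathfrak{S}_d$-modules over $\mathbb{Q}$. 3. Call $(a_1,\dots,a_n) \in \mathbb{Z}_{\ge 0}^n$ $(n,d)$-substaircase if it is componentwise $\le$ some shuffle (interleaving preserving the order of each sequence)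 of $(0,1,\dots,d-1)$ and the constant sequence $(d-1,\dots,d-1)$ of length $n-d$. The set $$\mathcal{A}_{n,k,d} = \{x_1^{a_1}\cdots x_n^{a_n} y_1^{b_1}\cdots y_d^{b_d} : (a_1,\dots,a_n) \text{ is } (n,d)\text{-substaircase and } 0 \le b_i < k-d+i \text{ for } 1 \le i \le d\}$$ is the standard monomial basis of $\mathbb{Q}[\mathbf{x},\mathbf{y}]/\mathrm{gr}\,\mathbf{I}(\mathcal{Z})$ for the lexicographical order with $x_1 > \cdots > x_n > y_1 > \cdots > y_d$: it is exactly the set of monomials not lying in the ideal generated by the lexicographically largest monomials of the nonzero elements of $\mathrm{gr}\,\mathbf{I}(\mathcal{Z})$, and it descends to a $\mathbb{Q}$-basis of the quotient. -/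

import Mathlib

namespace OrbitHarmonics

open MvPolynomial

noncomputable section

/-! ### Associated graded ideals and initial ideals -/

section General

variable {σ : Type*}

/-- The top degree homogeneous component `τ(f)` of a polynomial. -/
def topComponent (f : MvPolynomial σ ℚ) : MvPolynomial σ ℚ :=
  homogeneousComponent f.totalDegree f

/-- The associated graded ideal `gr I = (τ(f) : f ∈ I, f ≠ 0)`. -/
def grIdeal (I : Ideal (MvPolynomial σ ℚ)) : Ideal (MvPolynomial σ ℚ) :=
  Ideal.span {g | ∃ f ∈ I, f ≠ 0 ∧ g = topComponent f}

/-- The initial ideal of `I` with respect to the lexicographic term order in which a variable is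
larger when its index is smaller: it is generated by the lexicographically largest monomials of
the nonzero elements of `I`. -/
def lexInitialIdeal [LinearOrder σ] [WellFoundedGT σ] (I : Ideal (MvPolynomial σ ℚ)) :
    Ideal (MvPolynomial σ ℚ) :=
  Ideal.span {g | ∃ f ∈ I, f ≠ 0 ∧
    g = monomial ((MonomialOrder.lex (σ := σ)).degree f) (1 : ℚ)}

/-- The set of monomials with exponent vectors in `S` is the lexicographic standard monomial basis
of `ℚ[σ] / I`: it consists exactly of the monomials outside the initial ideal, and it descends
to a vector space basis of the quotient. -/
def IsLexStandardMonomialBasis [LinearOrder σ] [WellFoundedGT σ]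
    (I : Ideal (MvPolynomial σ ℚ)) (S : Set (σ →₀ ℕ)) : Prop :=
  S = {m | monomial m (1 : ℚ) ∉ lexInitialIdeal I} ∧
  LinearIndependent ℚ (fun m : S => Ideal.Quotient.mk I (monomial (m : σ →₀ ℕ) (1 : ℚ))) ∧
  Submodule.span ℚ
    (Set.range fun m : S => Ideal.Quotient.mk I (monomial (m : σ →₀ ℕ) (1 : ℚ))) = ⊤

theorem topComponent_rename {τ : Type*} (e : σ → τ) (he : Function.Injective e)
    (f : MvPolynomial σ ℚ) : topComponent (rename e f) = rename e (topComponent f) := by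
  unfold topComponent
  have hdeg : (rename e f).totalDegree = f.totalDegree := by
    refine (totalDegree_rename_le e f).antisymm (Finset.sup_le fun u hu => ?_)
    have hu' : u.mapDomain e ∈ (rename e f).support := by
      rw [mem_support_iff, coeff_rename_mapDomain _ he]
      exact mem_support_iff.1 hu
    have h := le_totalDegree hu'
    change (u.mapDomain e).degree ≤ _ at h
    rwa [Finsupp.degree_mapDomain] at h
  rw [hdeg]
  ext m
  rw [coeff_homogeneousComponent]
  by_cases hm : ∃ u : σ →₀ ℕ, u.mapDomain e = m
  · obtain ⟨u, rfl⟩ := hm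
    rw [coeff_rename_mapDomain _ he, coeff_rename_mapDomain _ he, coeff_homogeneousComponent,
      Finsupp.degree_mapDomain]
  · have h : ∀ p : MvPolynomial σ ℚ, coeff m (rename e p) = 0 := fun p =>
      coeff_rename_eq_zero _ _ _ fun u hu => absurd ⟨u, hu⟩ hm
    rw [h, h, ite_self]

theorem grIdeal_rename_mem (e : σ → σ) (he : Function.Injective e)
    {I : Ideal (MvPolynomial σ ℚ)} (hI : ∀ f ∈ I, rename e f ∈ I)
    {f : MvPolynomial σ ℚ} (hf : f ∈ grIdeal I) : rename e f ∈ grIdeal I := by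
  suffices h : grIdeal I ≤ (grIdeal I).comap (rename e : MvPolynomial σ ℚ →ₐ[ℚ] _) from h hf
  refine Ideal.span_le.2 ?_
  rintro _ ⟨g, hg, hg0, rfl⟩
  refine Ideal.subset_span ⟨rename e g, hI g hg, ?_, (topComponent_rename e he g).symm⟩
  exact fun h => hg0 (rename_injective e he (by rw [h, map_zero]))

end General

/-! ### Staircases -/

/-- `IsShuffle a b c`: the list `c` is an interleaving of the lists `a` and `b` which preserves
the relative orders in `a` and in `b`. -/
inductive IsShuffle {A : Type*} : List A → List A → List A → Prop
  | nil : IsShuffle [] [] []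
  | left {a b c : List A} (x : A) : IsShuffle a b c → IsShuffle (x :: a) b (x :: c)
  | right {a b c : List A} (x : A) : IsShuffle a b c → IsShuffle a (x :: b) (x :: c)

/-- `(n,d)`-staircases: shuffles of `(0,1,…,d-1)` and `(d-1,…,d-1)` (with `n-d` entries). -/
def IsStaircase {n : ℕ} (d : ℕ) (s : Fin n → ℕ) : Prop :=
  IsShuffle (List.range d) (List.replicate (n - d) (d - 1)) (List.ofFn s)

/-- `(n,d)`-substaircase sequences: componentwise `≤` at least one `(n,d)`-staircase. -/
def IsSubstaircase {n : ℕ} (d : ℕ) (e : Fin n → ℕ) : Prop :=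
  ∃ s : Fin n → ℕ, IsStaircase d s ∧ ∀ i, e i ≤ s i

/-! ### The ring `ℚ[x₁,…,xₙ,y₁,…,y_d]`, the locus and the ideal -/

/-- Indices of the variables `x₁, …, xₙ, y₁, …, y_d`, listed in this order. -/
abbrev Vars (n d : ℕ) : Type := Fin n ⊕ₗ Fin d

/-- The index of `x_{i+1}`. -/
abbrev xv {n : ℕ} (d : ℕ) (i : Fin n) : Vars n d := Sum.inlₗ i

/-- The index of `y_{j+1}`. -/
abbrev yv (n : ℕ) {d : ℕ} (j : Fin d) : Vars n d := Sum.inrₗ j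

/-- The ring `ℚ[x₁,…,xₙ,y₁,…,y_d]`. -/
abbrev Poly (n d : ℕ) : Type := MvPolynomial (Vars n d) ℚ

/-- The elementary symmetric polynomial `e_r(x₁,…,xₙ)`. -/
def ex (n d r : ℕ) : Poly n d := rename (xv d) (esymm (Fin n) ℚ r)

/-- The elementary symmetric polynomial `e_r(y₁,…,y_d)`. -/
def ey (n d r : ℕ) : Poly n d := rename (yv n) (esymm (Fin d) ℚ r)

/-- The complete homogeneous symmetric polynomial `h_r(y₁,…,y_d)`. -/
def hy (n d r : ℕ) : Poly n d := rename (yv n) (hsymm (Fin d) ℚ r)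

/-- The locus of points `(z₁,…,zₙ; z_{n+1},…,z_{n+d})` with all coordinates in `{α₁,…,α_k}`, the
last `d` coordinates distinct, and `{z₁,…,zₙ} = {z_{n+1},…,z_{n+d}}`. -/
def locus (n d : ℕ) {k : ℕ} (α : Fin k → ℚ) : Set (Vars n d → ℚ) :=
  {z | (∀ v, z v ∈ Set.range α) ∧
    Function.Injective (fun j : Fin d => z (yv n j)) ∧
    Set.range (fun i : Fin n => z (xv d i)) = Set.range (fun j : Fin d => z (yv n j))}

/-- The ideal `J^ℚ_{n,k,d}` (used for `d ≤ k` and `d ≤ n`). -/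
def idealJ (n k d : ℕ) : Ideal (Poly n d) :=
  Ideal.span
    ({g | ∃ r : ℕ, k - d < r ∧ g = hy n d r} ∪
     {g | ∃ r : ℕ, n - d < r ∧
        g = ∑ b ∈ Finset.range (r + 1), (-1) ^ b * ex n d (r - b) * hy n d b} ∪
     {g | ∃ i : Fin n,
        g = ∑ b ∈ Finset.range (d + 1), (-1) ^ b * X (xv d i) ^ (d - b) * ey n d b})

/-- The exponent vectors of the monomials in `𝒜_{n,k,d}` (used for `d ≤ k` and `d ≤ n`):
`(a₁,…,aₙ)` is `(n,d)`-substaircase and `b_i < k - d + i` for `1 ≤ i ≤ d`. -/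
def setA (n k d : ℕ) : Set (Vars n d →₀ ℕ) :=
  {m | IsSubstaircase d (fun i : Fin n => m (xv d i)) ∧
    ∀ j : Fin d, m (yv n j) < k - d + ((j : ℕ) + 1)}

/-! ### The action of the symmetric group on the `y`-variables -/

/-- The permutation of the variables that fixes every `x_i` and sends `y_j` to `y_{w(j)}`. -/
def permVars (n : ℕ) {d : ℕ} (w : Equiv.Perm (Fin d)) (v : Vars n d) : Vars n d :=
  toLex (Sum.map id w (ofLex v))

theorem permVars_injective (n : ℕ) {d : ℕ} (w : Equiv.Perm (Fin d)) :
    Function.Injective (permVars n w) :=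
  toLex.injective.comp
    ((Sum.map_injective.2 ⟨Function.injective_id, w.injective⟩).comp ofLex.injective)

/-- The action of `𝔖_d` on `ℚ[x₁,…,xₙ,y₁,…,y_d]` by permutation of the `y`-variables. -/
def polyRep (n d : ℕ) : Representation ℚ (Equiv.Perm (Fin d)) (Poly n d) where
  toFun w := (rename (permVars n w)).toLinearMap
  map_one' := by
    have h : permVars n (1 : Equiv.Perm (Fin d)) = id := by
      funext v; rcases v with v | v <;> rfl
    refine LinearMap.ext fun f => ?_
    simp [h, rename_id]
  map_mul' w w' := by
    have h : permVars n (w * w') = permVars n w ∘ permVars n w' := by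
      funext v; rcases v with v | v <;> rfl
    refine LinearMap.ext fun f => ?_
    simp [h, rename_rename]

theorem rename_mem_vanishingIdeal (n d : ℕ) {k : ℕ} (α : Fin k → ℚ) (w : Equiv.Perm (Fin d))
    (f : Poly n d) (hf : f ∈ vanishingIdeal ℚ (locus n d α)) :
    rename (permVars n w) f ∈ vanishingIdeal ℚ (locus n d α) := by
  intro z hz
  rw [aeval_rename]
  refine hf _ ⟨fun v => hz.1 _, fun i j hij => w.injective (hz.2.1 hij), ?_⟩
  have h := w.surjective.range_comp (fun j : Fin d => z (yv n j))
  exact hz.2.2.trans h.symm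

/-- The `𝔖_d`-module `ℚ[𝒵] = ℚ[x,y] / I(𝒵)`. -/
def coordRingRep (n d : ℕ) {k : ℕ} (α : Fin k → ℚ) :
    Representation ℚ (Equiv.Perm (Fin d))
      (Poly n d ⧸ (vanishingIdeal ℚ (locus n d α)).restrictScalars ℚ) :=
  (polyRep n d).quotient _ fun w f hf => rename_mem_vanishingIdeal n d α w f hf

/-- The `𝔖_d`-module `ℚ[x,y] / gr I(𝒵)`. -/
def grQuotientRep (n d : ℕ) {k : ℕ} (α : Fin k → ℚ) :
    Representation ℚ (Equiv.Perm (Fin d))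
      (Poly n d ⧸ (grIdeal (vanishingIdeal ℚ (locus n d α))).restrictScalars ℚ) :=
  (polyRep n d).quotient _ fun w _ hf =>
    grIdeal_rename_mem (permVars n w) (permVars_injective n w)
      (rename_mem_vanishingIdeal n d α w) hf

end

end OrbitHarmonics

/-!
Write `P = ℚ[x, y]`, let `I` be the vanishing ideal of the locus, `J` the ideal of the three
families of generators and `A` the set of exponents in question. The theorem follows from
`J ≤ gr I`, from `#A ≤ dim P / gr I`, and from the fact that every monomial outside `A` is divisible
by the leading monomial of some element of `J`: see `eq_and_isLexStandardMonomialBasis`.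

*The isomorphism.* A projection of `P` onto `gr I` which preserves degrees can be averaged over
`𝔖_d`. Subtracting such a projection `π` induces an equivariant isomorphism from `P / gr I` to
`P / I` (`IsGradedProjection.exists_linearEquiv`). In particular `P / gr I` has the number of points
of the locus as its dimension.

*The inclusion `J ≤ gr I`.* On the locus the `y_j` are distinct and occur both among the `α_a` and
among the `x_i`, so that `∏ (1 - α_a T) / ∏ (1 - y_j T)` and `∏ (1 - x_i T) / ∏ (1 - y_j T)` are
polynomials in `T` of degrees at most `k - d` and `n - d`. Their higher coefficients vanish on the
locus, and have the first two families of generators as top components up to sign. The generators of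
the third family are the products `∏_j (x_i - y_j)`.

*Leading monomials.* The complete homogeneous polynomial of degree `k - d + j` in `y_j, …, y_d` lies
in `J` and leads with a power of `y_j`, and `∏_j (x_i - y_j)` leads with `x_i ^ d`. The remaining
elements come from determinantal ideals. Modulo `J` the polynomial `f = ∏ (T - y_j)` divides
`g = ∏ (x_i - T)`, so multiplication by `g` on `P[T] / (f)` has zero `1 × 1` minors. Now remove the
factors of `g` one at a time, starting with `x_1`. Removing `x - T` either keeps the size `s` of the
minors, and then `x ^ s` times a minor of the remaining product is the leading part of a minor of
the whole product (`exists_mem_minorIdeal_coeff_eq`); or it raises the size to `s + 1` without a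
factor `x`, as the cokernel of multiplication by `x - T` is cyclic (`minorIdeal_succ_le`). When all factors
are removed, what is left is the identity, whose minors of size at most `d` generate the unit ideal.
The exponents reached in this way are those at which a greedy matching of `(a_1, …, a_n)` against
`(0, 1, …, d - 1)` fails (`exists_mem_minorIdeal_hasLexLead`), and a sequence with entries below `d`
is substaircase if and only if this matching succeeds (`isSubstaircase_iff`).

*Counting.* Sequences on which the greedy matching succeeds satisfy the same recursion as words in
`d` letters with a prescribed minimal number of distinct letters (`card_not_greedyFails`), so there
are as many substaircase sequences as surjections from `n` to `d` letters. The exponents of the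
`y`-variables are counted by the embeddings of `d` letters into `k` letters.
-/

namespace OrbitHarmonics

noncomputable section

/-! ### Ideals of minors of multiplication operators -/

section Minors

open Polynomial

variable {R : Type*} [CommRing R]

/-- The ideal generated by the `s × s` minors of multiplication by `g` on `R[T] / (f)`, for `f`
monic. The factors `q l` range over all polynomials instead of over a basis; this gives the same
ideal, and ring homomorphisms visibly map generators to generators. -/
def minorIdeal (f g : R[X]) (s : ℕ) : Ideal R :=
  Ideal.span {x | ∃ (q : Fin s → R[X]) (r : Fin s → ℕ),
    x = (Matrix.of fun l p => ((g * q l) %ₘ f).coeff (r p)).det}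

theorem det_mem_minorIdeal (f g : R[X]) {s : ℕ} (q : Fin s → R[X]) (r : Fin s → ℕ) :
    (Matrix.of fun l p => ((g * q l) %ₘ f).coeff (r p)).det ∈ minorIdeal f g s :=
  Ideal.subset_span ⟨q, r, rfl⟩

theorem map_mem_minorIdeal {S : Type*} [CommRing S] (φ : R →+* S) {f g : R[X]} (hf : f.Monic)
    {s : ℕ} {u : R} (hu : u ∈ minorIdeal f g s) :
    φ u ∈ minorIdeal (f.map φ) (g.map φ) s := by
  suffices h : minorIdeal f g s ≤ (minorIdeal (f.map φ) (g.map φ) s).comap φ from h hu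
  refine Ideal.span_le.2 ?_
  rintro _ ⟨q, r, rfl⟩
  refine Ideal.subset_span ⟨fun l => (q l).map φ, r, ?_⟩
  rw [RingHom.map_det]
  congr 1
  ext l p
  simp [← Polynomial.map_mul, ← Polynomial.map_modByMonic _ hf]

theorem minorIdeal_one_eq_top [Nontrivial R] {f : R[X]} (hf : f.Monic) {s : ℕ}
    (hs : s ≤ f.natDegree) : minorIdeal f 1 s = ⊤ := by
  rw [Ideal.eq_top_iff_one]
  convert det_mem_minorIdeal f 1 (fun l : Fin s => (X : R[X]) ^ (l : ℕ)) (fun p => (p : ℕ))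
  rw [← Matrix.det_one (n := Fin s)]
  congr 1
  ext l p
  have h : (X ^ (l : ℕ) : R[X]) %ₘ f = X ^ (l : ℕ) := by
    rw [modByMonic_eq_self_iff hf, degree_X_pow, degree_eq_natDegree hf.ne_zero]
    exact_mod_cast l.2.trans_le hs
  simp [h, coeff_X_pow, Matrix.one_apply, Fin.ext_iff, eq_comm]

/-- A determinant all of whose rows but one come from multiples of `g` lies in the ideal of minors
of one size less: expand it along the remaining row. -/
theorem det_mem_minorIdeal_of_forall_ne (f g : R[X]) {s : ℕ} (q : Fin (s + 1) → R[X])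
    (r : Fin (s + 1) → ℕ) (A : Matrix (Fin (s + 1)) (Fin (s + 1)) R) (i : Fin (s + 1))
    (hA : ∀ l, l ≠ i → ∀ p, A l p = ((g * q l) %ₘ f).coeff (r p)) :
    A.det ∈ minorIdeal f g s := by
  rw [Matrix.det_succ_row A i]
  refine Ideal.sum_mem _ fun j _ => Ideal.mul_mem_left _ _ ?_
  convert det_mem_minorIdeal f g (fun l => q (i.succAbove l)) (fun p => r (j.succAbove p))
  ext l p
  simp [hA _ (Fin.succAbove_ne i l)]

/-- The cokernel of multiplication by `x - T` is cyclic, so that multiplying by `x - T` lowers the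
rank by at most one: minors of size `s + 1` before are combinations of minors of size `s` after. -/
theorem minorIdeal_succ_le (f g : R[X]) (x : R) (s : ℕ) :
    minorIdeal f g (s + 1) ≤ minorIdeal f ((C x - X) * g) s := by
  refine Ideal.span_le.2 ?_
  rintro _ ⟨q, r, rfl⟩
  -- Write each `q l` as a constant plus a multiple of `x - T`, and expand multilinearly.
  let q' : Fin (s + 1) → R[X] := fun l => -(q l /ₘ (X - C x))
  let c : Fin (s + 1) → R := fun l => (q l).eval x
  let v : Fin (s + 1) → R := fun p => (g %ₘ f).coeff (r p)
  let w : Fin (s + 1) → Fin (s + 1) → R := fun l p =>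
    ((((C x - X) * g) * q' l) %ₘ f).coeff (r p)
  have hq : ∀ l, g * q l = C (c l) * g + ((C x - X) * g) * q' l := fun l => by
    have := modByMonic_add_div (q l) (X - C x)
    rw [modByMonic_X_sub_C_eq_C_eval] at this
    conv_lhs => rw [← this]
    ring
  have hM : (Matrix.of fun l p => ((g * q l) %ₘ f).coeff (r p)).det =
      (Matrix.detRowAlternating : (Fin (s + 1) → R) [⋀^Fin (s + 1)]→ₗ[R] R).toMultilinearMap
        ((fun l => c l • v) + w) := by
    change _ = Matrix.det _
    congr 1
    ext l p
    simp only [Matrix.of_apply, hq, add_modByMonic, coeff_add, Pi.add_apply, Pi.smul_apply]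
    rw [← smul_eq_C_mul, smul_modByMonic, coeff_smul]
  rw [SetLike.mem_coe, hM, MultilinearMap.map_add_univ]
  refine Ideal.sum_mem _ fun S _ => ?_
  by_cases hS : ∃ i, S ⊆ {i}
  · obtain ⟨i, hi⟩ := hS
    refine det_mem_minorIdeal_of_forall_ne f _ q' r _ i fun l hl p => ?_
    have : l ∉ S := fun h => hl (by simpa using hi h)
    simp [Finset.piecewise, this, w]
  · have hS' : ∃ i ∈ S, ∃ j ∈ S, i ≠ j := by
      by_contra! h
      rcases S.eq_empty_or_nonempty with rfl | ⟨i, hi⟩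
      · exact hS ⟨0, by simp⟩
      · exact hS ⟨i, fun j hj => by simp [h i hi j hj]⟩
    obtain ⟨i, hi, j, hj, hij⟩ := hS'
    have hpw : S.piecewise (fun l => c l • v) w =
        S.piecewise (fun l => c l • (S.piecewise (fun _ => v) w) l)
          (S.piecewise (fun _ => v) w) := by
      funext l
      by_cases hl : l ∈ S <;> simp [hl]
    rw [hpw, MultilinearMap.map_piecewise_smul]
    refine (minorIdeal f _ s).smul_of_tower_mem _ ?_
    convert Ideal.zero_mem _
    exact AlternatingMap.map_eq_zero_of_eq _ _ (by simp [hi, hj]) hij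

/-- Multiplying by `x - T` with `x` a new variable, a minor of size `s` becomes the coefficient
of `x ^ s` in a minor of size `s`. -/
theorem exists_mem_minorIdeal_coeff_eq {f : R[X]} (hf : f.Monic) (g : R[X]) (s : ℕ) {u : R}
    (hu : u ∈ minorIdeal f g s) :
    ∃ F ∈ minorIdeal (f.map (C : R →+* R[X])) ((C X - X) * g.map (C : R →+* R[X])) s,
      F.natDegree ≤ s ∧ F.coeff s = u := by
  induction hu using Submodule.span_induction with
  | mem u hu =>
    obtain ⟨q, r, rfl⟩ := hu
    let A : Matrix (Fin s) (Fin s) R := Matrix.of fun l p => ((g * q l) %ₘ f).coeff (r p)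
    let A' : Matrix (Fin s) (Fin s) R := -Matrix.of fun l p => ((X * (g * q l)) %ₘ f).coeff (r p)
    refine ⟨((X : R[X]) • A.map C + A'.map C).det, ?_, ?_, ?_⟩
    · convert det_mem_minorIdeal _ _ (fun l => (q l).map (C : R →+* R[X])) r using 2
      ext1 l p
      have h : (C (X : R[X]) - X) * g.map C * (q l).map C =
          (X : R[X]) • (g * q l).map C - (X * (g * q l)).map C := by
        rw [smul_eq_C_mul]
        simp only [Polynomial.map_mul, map_X]
        ring
      simp only [Matrix.of_apply, h, sub_modByMonic, smul_modByMonic,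
        ← Polynomial.map_modByMonic _ hf, coeff_sub, coeff_smul, coeff_map]
      simp [A, A', sub_eq_add_neg]
    · simpa using natDegree_det_X_add_C_le A A'
    · simpa using coeff_det_X_add_C_card A A'
  | zero => exact ⟨0, Ideal.zero_mem _, by simp, by simp⟩
  | add u v _ _ hu hv =>
    obtain ⟨F, hF, hF', rfl⟩ := hu
    obtain ⟨G, hG, hG', rfl⟩ := hv
    exact ⟨F + G, Ideal.add_mem _ hF hG, natDegree_add_le_of_degree_le hF' hG', by simp⟩
  | smul c u _ hu =>
    obtain ⟨F, hF, hF', rfl⟩ := hu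
    exact ⟨C c * F, Ideal.mul_mem_left _ _ hF, (natDegree_C_mul_le _ _).trans hF', by simp⟩

end Minors

/-! ### Leading monomials -/

section Lead

open MvPolynomial

variable {R : Type*} [CommRing R] {n : ℕ}

/-- `F` is lexicographically monic with leading exponent `a`. -/
def HasLexLead (F : MvPolynomial (Fin n) R) (a : Fin n →₀ ℕ) : Prop :=
  F.coeff a = 1 ∧ ∀ m ∈ F.support, toLex m ≤ toLex a

theorem lex_cons_lt_of_lt {i j : ℕ} (h : i < j) (m a : Fin n →₀ ℕ) :
    toLex (m.cons i) < toLex (a.cons j) := by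
  rw [Finsupp.Lex.lt_iff]
  exact ⟨0, fun k hk => absurd hk (Fin.not_lt_zero k), by simpa using h⟩

theorem lex_cons_le_of_le (i : ℕ) {m a : Fin n →₀ ℕ} (h : toLex m ≤ toLex a) :
    toLex (m.cons i) ≤ toLex (a.cons i) := by
  rcases h.eq_or_lt with h | h
  · rw [toLex.injective h]
  · refine le_of_lt ?_
    rw [Finsupp.Lex.lt_iff] at h ⊢
    obtain ⟨k, hk, hlt⟩ := h
    refine ⟨k.succ, fun l hl => ?_, by simpa using hlt⟩
    rcases Fin.eq_zero_or_eq_succ l with rfl | ⟨l, rfl⟩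
    · simp
    · simpa using hk l (by simpa using hl)

theorem HasLexLead.finSuccEquiv_symm {F : Polynomial (MvPolynomial (Fin n) R)} {t : ℕ}
    (hF : F.natDegree ≤ t) {a : Fin n →₀ ℕ} (ha : HasLexLead (F.coeff t) a) :
    HasLexLead ((finSuccEquiv R n).symm F) (a.cons t) := by
  have hc : ∀ m : Fin (n + 1) →₀ ℕ, coeff m ((finSuccEquiv R n).symm F) =
      coeff m.tail (F.coeff (m 0)) := fun m => by
    conv_lhs => rw [← Finsupp.cons_tail m]
    rw [← finSuccEquiv_coeff_coeff, AlgEquiv.apply_symm_apply]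
  refine ⟨by simpa [hc] using ha.1, fun m hm => ?_⟩
  rw [mem_support_iff, hc] at hm
  rw [← Finsupp.cons_tail m]
  rcases lt_trichotomy (m 0) t with h | h | h
  · exact (lex_cons_lt_of_lt h _ _).le
  · rw [h] at hm ⊢
    exact lex_cons_le_of_le t (ha.2 _ (mem_support_iff.2 hm))
  · rw [Polynomial.coeff_eq_zero_of_natDegree_lt (hF.trans_lt h)] at hm
    simp at hm

/-- `GreedyFails d s a`: matching the sequence `a` greedily from the left against
`s - 1, s, …, d - 1`, where an entry is matched with the current value if it is at most that value
and is skipped otherwise, does not match all of these values. -/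
def GreedyFails (d : ℕ) : ∀ {n : ℕ}, ℕ → (Fin n → ℕ) → Prop
  | 0, s, _ => s ≤ d
  | _ + 1, s, a =>
    if a 0 < s then GreedyFails d (s + 1) (Fin.tail a) else GreedyFails d s (Fin.tail a)

/-- The exponents at which greedy matching fails are leading exponents in ideals of minors. An
entry that is matched uses `minorIdeal_succ_le`, an entry that is skipped uses
`exists_mem_minorIdeal_coeff_eq`. -/
theorem exists_mem_minorIdeal_hasLexLead [Nontrivial R] {f : Polynomial R} (hf : f.Monic) :
    ∀ {n : ℕ} (s : ℕ) (a : Fin n → ℕ), GreedyFails f.natDegree s a →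
      ∃ F ∈ minorIdeal (f.map (C : R →+* MvPolynomial (Fin n) R))
        (∏ i, (Polynomial.C (X i) - Polynomial.X)) s,
        HasLexLead F (Finsupp.equivFunOnFinite.symm a)
  | 0, s, a, ha => by
    refine ⟨1, ?_, ?_, fun m hm => ?_⟩
    · rw [Fin.prod_univ_zero, minorIdeal_one_eq_top (hf.map _)]
      · trivial
      · rw [hf.natDegree_map]
        exact ha
    · rw [Subsingleton.elim (Finsupp.equivFunOnFinite.symm a) 0, coeff_zero_one]
    · rw [Subsingleton.elim m (Finsupp.equivFunOnFinite.symm a)]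
  | n + 1, s, a, ha => by
    let e : Polynomial (MvPolynomial (Fin n) R) →+* MvPolynomial (Fin (n + 1)) R :=
      ((finSuccEquiv R n).symm : _ →ₐ[R] _).toRingHom
    have he0 : e Polynomial.X = X 0 := (finSuccEquiv R n).symm_apply_eq.2 finSuccEquiv_X_zero.symm
    have heX : ∀ i, e (Polynomial.C (X i)) = X i.succ := fun i =>
      (finSuccEquiv R n).symm_apply_eq.2 finSuccEquiv_X_succ.symm
    have heC : ∀ r, e (Polynomial.C (C r)) = C r := fun r =>
      (finSuccEquiv R n).symm_apply_eq.2 (by simp [finSuccEquiv_apply])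
    let f' := f.map (C : R →+* MvPolynomial (Fin n) R)
    have hf' : f'.Monic := hf.map _
    let g' : Polynomial (MvPolynomial (Fin n) R) := ∏ i, (Polynomial.C (X i) - Polynomial.X)
    let g := (Polynomial.C Polynomial.X - Polynomial.X) * g'.map Polynomial.C
    suffices h : ∃ t ≤ a 0, ∃ F ∈ minorIdeal (f'.map Polynomial.C) g s,
        F.natDegree ≤ t ∧
          HasLexLead (F.coeff t) (Finsupp.equivFunOnFinite.symm (Fin.tail a)) by
      obtain ⟨t, ht, F, hF, hdeg, hlead⟩ := h
      refine ⟨e (F * Polynomial.X ^ (a 0 - t)), ?_, ?_⟩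
      · have h1 := map_mem_minorIdeal e (hf'.map _)
          (Ideal.mul_mem_right (Polynomial.X ^ (a 0 - t)) _ hF)
        convert h1 using 2
        · simp only [f', Polynomial.map_map]
          congr 1
          ext r : 1
          simp [heC]
        · simp only [g, g', Polynomial.map_mul, Polynomial.map_prod, Polynomial.map_sub,
            Polynomial.map_C, Polynomial.map_X, Fin.prod_univ_succ, he0, heX]
      · have h2 : Finsupp.equivFunOnFinite.symm a =
            (Finsupp.equivFunOnFinite.symm (Fin.tail a)).cons (a 0) := by
          ext i
          refine Fin.cases ?_ (fun i => ?_) i <;> simp [Fin.tail]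
        rw [h2]
        refine HasLexLead.finSuccEquiv_symm ?_ ?_
        · refine Polynomial.natDegree_mul_le.trans ?_
          rw [Polynomial.natDegree_X_pow]
          omega
        · rw [Polynomial.coeff_mul_X_pow', if_pos (by omega)]
          convert hlead using 2
          omega
    unfold GreedyFails at ha
    split_ifs at ha with h0
    · obtain ⟨F, hF, hlead⟩ := exists_mem_minorIdeal_hasLexLead hf _ _ ha
      refine ⟨0, Nat.zero_le _, Polynomial.C F, ?_, by simp, by simpa using hlead⟩
      have h1 : Polynomial.C F ∈ minorIdeal (f'.map Polynomial.C) (g'.map Polynomial.C) (s + 1) :=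
        map_mem_minorIdeal Polynomial.C hf' hF
      have h2 := minorIdeal_succ_le (f'.map Polynomial.C) (g'.map Polynomial.C) Polynomial.X s
      exact h2 h1
    · obtain ⟨u, hu, hlead⟩ := exists_mem_minorIdeal_hasLexLead hf _ _ ha
      obtain ⟨F, hF, hdeg, rfl⟩ := exists_mem_minorIdeal_coeff_eq hf' g' s hu
      exact ⟨s, not_lt.1 h0, F, hF, hdeg, hlead⟩

end Lead

end

/-! ### Substaircase sequences and greedy matching -/

section Staircase

theorem IsShuffle.of_cons {A : Type*} {a b c : List A} {x : A} (h : IsShuffle a b (x :: c)) :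
    (∃ a', a = x :: a' ∧ IsShuffle a' b c) ∨ ∃ b', b = x :: b' ∧ IsShuffle a b' c := by
  cases h with
  | left _ h => exact .inl ⟨_, rfl, h⟩
  | right _ h => exact .inr ⟨_, rfl, h⟩

theorem IsShuffle.eq_nil_of_nil {A : Type*} {a b : List A} (h : IsShuffle a b []) : a = [] := by
  cases h
  rfl

/-- Failure is antitone in the number of values matched beforehand. -/
theorem GreedyFails.of_succ {d : ℕ} :
    ∀ {n s : ℕ} {a : Fin n → ℕ}, GreedyFails d (s + 1) a → GreedyFails d s a
  | 0, s, _, h => (Nat.le_succ s).trans h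
  | n + 1, s, a, h => by
    unfold GreedyFails at h ⊢
    by_cases h1 : a 0 < s
    · rw [if_pos h1]
      rw [if_pos (h1.trans (Nat.lt_succ_self s))] at h
      exact h.of_succ
    · rw [if_neg h1]
      split_ifs at h
      · exact h.of_succ.of_succ
      · exact h.of_succ

theorem not_greedyFails_of_lt {d : ℕ} :
    ∀ {n s : ℕ} (a : Fin n → ℕ), d < s → ¬ GreedyFails d s a
  | 0, _, _, h => not_le.2 h
  | n + 1, s, a, h => by
    unfold GreedyFails
    split_ifs
    · exact not_greedyFails_of_lt _ (by omega)
    · exact not_greedyFails_of_lt _ h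

theorem lt_add_of_not_greedyFails {d : ℕ} :
    ∀ {n s : ℕ} {a : Fin n → ℕ}, ¬ GreedyFails d s a → d < s + n
  | 0, s, _, h => by simpa [GreedyFails] using h
  | n + 1, s, a, h => by
    unfold GreedyFails at h
    split_ifs at h
    · have := lt_add_of_not_greedyFails h
      omega
    · have := lt_add_of_not_greedyFails h
      omega

/-- Matching greedily is optimal: below a staircase it succeeds, since an early match never hurts by
`GreedyFails.of_succ`. -/
theorem not_greedyFails_of_isShuffle {d : ℕ} (hd : 0 < d) :
    ∀ {n c m : ℕ} {a s : Fin n → ℕ},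
      IsShuffle (List.range' c (d - c)) (List.replicate m (d - 1)) (List.ofFn s) →
      (∀ i, a i ≤ s i) → ¬ GreedyFails d (c + 1) a ∧ ∀ i, a i < d
  | 0, c, m, a, s, h, _ => by
    refine ⟨?_, fun i => i.elim0⟩
    rw [List.ofFn_zero] at h
    have := congrArg List.length h.eq_nil_of_nil
    simp only [List.length_range', List.length_nil] at this
    unfold GreedyFails
    omega
  | n + 1, c, m, a, s, h, ha => by
    rw [List.ofFn_succ] at h
    rcases h.of_cons with ⟨l, hl, h⟩ | ⟨l, hl, h⟩
    · obtain ⟨e, he⟩ : ∃ e, d - c = e + 1 := by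
        rcases hdc : d - c with _ | e
        · simp [hdc] at hl
        · exact ⟨e, rfl⟩
      rw [he, List.range'_succ, List.cons.injEq] at hl
      obtain ⟨h0, rfl⟩ := hl
      rw [show e = d - (c + 1) by omega] at h
      obtain ⟨h1, h2⟩ := not_greedyFails_of_isShuffle hd (a := Fin.tail a) h fun i => ha i.succ
      have h3 := ha 0
      refine ⟨?_, Fin.cases (by omega) h2⟩
      unfold GreedyFails
      rwa [if_pos (by omega)]
    · obtain ⟨e, rfl⟩ : ∃ e, m = e + 1 := by
        rcases m with _ | e
        · simp at hl
        · exact ⟨e, rfl⟩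
      rw [List.replicate_succ, List.cons.injEq] at hl
      obtain ⟨h0, rfl⟩ := hl
      obtain ⟨h1, h2⟩ := not_greedyFails_of_isShuffle hd (a := Fin.tail a) h fun i => ha i.succ
      have h3 := ha 0
      refine ⟨?_, Fin.cases (by omega) h2⟩
      unfold GreedyFails
      split_ifs
      · exact fun h => h1 h.of_succ
      · exact h1

/-- A successful greedy matching produces a staircase above the sequence. -/
theorem exists_isShuffle_of_not_greedyFails {d : ℕ} :
    ∀ {n c m : ℕ} {a : Fin n → ℕ}, (∀ i, a i < d) → ¬ GreedyFails d (c + 1) a →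
      n = m + (d - c) → ∃ s : Fin n → ℕ,
        IsShuffle (List.range' c (d - c)) (List.replicate m (d - 1)) (List.ofFn s) ∧
          ∀ i, a i ≤ s i
  | 0, c, m, a, _, _, hn => by
    have h1 : d - c = 0 := by omega
    have h2 : m = 0 := by omega
    exact ⟨a, by simpa [h1, h2] using IsShuffle.nil, fun _ => le_rfl⟩
  | n + 1, c, m, a, had, ha, hn => by
    have hda := lt_add_of_not_greedyFails ha
    unfold GreedyFails at ha
    -- Match the first entry with `c` if the greedy procedure does so, and with `d - 1` otherwise.
    by_cases h0 : a 0 < c + 1 ∧ c < d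
    · rw [if_pos h0.1] at ha
      obtain ⟨s, hs, has⟩ := exists_isShuffle_of_not_greedyFails (c := c + 1) (m := m)
        (a := Fin.tail a) (fun i => had _) ha (by omega)
      refine ⟨Fin.cons c s, ?_, Fin.cases (by simpa using Nat.lt_succ_iff.1 h0.1) has⟩
      rw [List.ofFn_succ, show d - c = d - (c + 1) + 1 by omega, List.range'_succ]
      simpa using hs.left c
    · have ha' : ¬ GreedyFails d (c + 1) (Fin.tail a) ∨ d ≤ c := by
        split_ifs at ha with h1
        · right
          by_contra h2
          exact h0 ⟨h1, by omega⟩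
        · exact .inl ha
      have ha'' : ¬ GreedyFails d (c + 1) (Fin.tail a) := by
        rcases ha' with h | h
        · exact h
        · exact not_greedyFails_of_lt _ (by omega)
      have hda' := lt_add_of_not_greedyFails ha''
      obtain ⟨e, rfl⟩ : ∃ e, m = e + 1 := ⟨m - 1, by omega⟩
      obtain ⟨s, hs, has⟩ := exists_isShuffle_of_not_greedyFails (c := c) (m := e)
        (a := Fin.tail a) (fun i => had _) ha'' (by omega)
      refine ⟨Fin.cons (d - 1) s, ?_, Fin.cases (by simpa using Nat.le_sub_one_of_lt (had 0)) has⟩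
      rw [List.ofFn_succ, List.replicate_succ]
      simpa using hs.right (d - 1)

theorem isSubstaircase_iff {n d : ℕ} (hd : 0 < d) (hdn : d ≤ n) (a : Fin n → ℕ) :
    IsSubstaircase d a ↔ ¬ GreedyFails d 1 a ∧ ∀ i, a i < d := by
  unfold IsSubstaircase IsStaircase
  rw [List.range_eq_range']
  constructor
  · rintro ⟨s, hs, has⟩
    exact not_greedyFails_of_isShuffle hd (c := 0) hs has
  · rintro ⟨h1, h2⟩
    exact exists_isShuffle_of_not_greedyFails (c := 0) h2 h1 (by omega)

end Staircase

/-! ### Counting substaircase sequences -/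

section Counting

open Finset

open scoped Classical in
/-- Greedy matching and words with many letters satisfy the same recursion in the length, obtained
by removing the first entry. -/
theorem card_not_greedyFails (d : ℕ) : ∀ n s : ℕ, 1 ≤ s →
    #{a : Fin n → Fin d | ¬ GreedyFails d s (fun i => (a i : ℕ))} =
      #{w : Fin n → Fin d | d + 1 - s ≤ #(univ.image w)}
  | 0, s, _ => by
    congr 1
    ext a
    rw [mem_filter, mem_filter]
    simp only [mem_univ, true_and, GreedyFails, univ_eq_empty, image_empty, card_empty]
    omega
  | n + 1, s, hs => by
    have hcons : ∀ (P : (Fin (n + 1) → Fin d) → Prop) [DecidablePred P],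
        #{a : Fin (n + 1) → Fin d | P a} =
          ∑ x : Fin d, #{a : Fin n → Fin d | P (Fin.cons x a)} := fun P _ => by
      simp only [card_filter]
      rw [← (Fin.consEquiv fun _ : Fin (n + 1) => Fin d).sum_comp, Fintype.sum_prod_type]
      rfl
    have himg : ∀ (x : Fin d) (w : Fin n → Fin d),
        univ.image (Fin.cons x w : Fin (n + 1) → Fin d) = insert x (univ.image w) := by
      intro x w
      ext y
      simp [Fin.exists_fin_succ, eq_comm]
    have hL : ∀ x : Fin d,
        #{a : Fin n → Fin d |
            ¬ GreedyFails d s (fun i => ((Fin.cons x a : Fin (n + 1) → Fin d) i : ℕ))} =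
          if (x : ℕ) < s then #{w : Fin n → Fin d | d - s ≤ #(univ.image w)}
          else #{w : Fin n → Fin d | d + 1 - s ≤ #(univ.image w)} := by
      intro x
      have h : ∀ a : Fin n → Fin d,
          GreedyFails d s (fun i => ((Fin.cons x a : Fin (n + 1) → Fin d) i : ℕ)) ↔
            if (x : ℕ) < s then GreedyFails d (s + 1) (fun i => (a i : ℕ))
            else GreedyFails d s (fun i => (a i : ℕ)) := fun a => by
        conv_lhs => unfold GreedyFails
        rfl
      simp only [h]
      split_ifs with hx
      · rw [card_not_greedyFails d n (s + 1) (by omega), Nat.add_sub_add_right]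
      · exact card_not_greedyFails d n s hs
    rw [hcons, sum_congr rfl fun x _ => hL x, hcons]
    simp only [himg]
    rcases lt_or_ge d s with hds | hds
    · have h1 : d - s = 0 := by omega
      have h2 : d + 1 - s = 0 := by omega
      simp [h1, h2]
    · obtain ⟨t, rfl⟩ : ∃ t, d = s + t := ⟨d - s, by omega⟩
      have h1 : s + t - s = t := by omega
      have h2 : s + t + 1 - s = t + 1 := by omega
      have hcard : #{x : Fin (s + t) | (x : ℕ) < s} = s := by
        rw [Fin.card_filter_val_lt]
        omega
      rw [h1, h2, sum_ite, sum_const, sum_const, filter_not,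
        card_sdiff_of_subset (filter_subset _ _), hcard]
      simp only [card_filter]
      rw [sum_comm, card_univ, Fintype.card_fin, h1, smul_sum, smul_sum, ← sum_add_distrib]
      refine sum_congr rfl fun w _ => ?_
      -- For fixed `w`, count the letters `x` for which `x :: w` has at least `t + 1` letters.
      set I := univ.image w with hI
      have hcI : #I ≤ s + t := (card_le_univ I).trans_eq (Fintype.card_fin _)
      rcases lt_trichotomy (#I) t with h | h | h
      · have : ∀ x, ¬ t + 1 ≤ #(insert x I) := fun x hx => by
          have := card_insert_le x I
          omega
        simp [this, not_le.2 h, not_le.2 (h.trans (Nat.lt_succ_self t))]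
      · have : ∀ x, (t + 1 ≤ #(insert x I)) ↔ x ∉ I := fun x => by
          by_cases hx : x ∈ I
          · simp [hx, h]
          · simp [hx, h, card_insert_of_notMem hx]
        simp only [this, h, le_refl, if_true, Nat.not_succ_le_self, if_false, 
          smul_eq_mul, mul_one]
        rw [← card_filter, filter_not, filter_mem_eq_inter, univ_inter,
          ← compl_eq_univ_sdiff, card_compl, Fintype.card_fin, h]
        omega
      · have : ∀ x, t + 1 ≤ #(insert x I) := fun x => by
          have := card_le_card (subset_insert x I)
          omega
        simp [this, h.le, Nat.succ_le_of_lt h]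

end Counting

open MvPolynomial

noncomputable section

/-! ### The quotient by the associated graded ideal -/

section Graded

variable {σ : Type*}

theorem homogeneousComponent_mem_grIdeal_of_forall_lt {I : Ideal (MvPolynomial σ ℚ)}
    {f : MvPolynomial σ ℚ} {r : ℕ} (hf : f ∈ I) (hr : ∀ m, r < m → homogeneousComponent m f = 0) :
    homogeneousComponent r f ∈ grIdeal I := by
  by_cases h0 : homogeneousComponent r f = 0
  · rw [h0]
    exact Ideal.zero_mem _
  · refine Ideal.subset_span ⟨f, hf, fun h => h0 (by rw [h, map_zero]), ?_⟩
    have h1 : r ≤ f.totalDegree := by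
      by_contra h
      exact h0 (homogeneousComponent_eq_zero _ _ (not_le.1 h))
    have h2 : f.totalDegree ≤ r := by
      refine Finset.sup_le fun m hm => ?_
      by_contra h
      have := congrArg (coeff m) (hr m.degree (not_le.1 h))
      rw [coeff_homogeneousComponent, if_pos rfl, coeff_zero] at this
      exact mem_support_iff.1 hm this
    rw [topComponent, h1.antisymm h2]

attribute [local instance] MvPolynomial.gradedAlgebra in
theorem homogeneousComponent_mem_grIdeal {I : Ideal (MvPolynomial σ ℚ)} {f : MvPolynomial σ ℚ}
    (hf : f ∈ grIdeal I) (m : ℕ) : homogeneousComponent m f ∈ grIdeal I := by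
  refine homogeneousComponent_mem_of_mem
    (Ideal.homogeneous_span (homogeneousSubmodule σ ℚ) _ ?_) hf m
  rintro _ ⟨g, -, -, rfl⟩
  exact ⟨_, homogeneousComponent_isHomogeneous _ _⟩

theorem homogeneousComponent_homogeneous_mul {a : MvPolynomial σ ℚ} {p : ℕ}
    (ha : a.IsHomogeneous p) (x : MvPolynomial σ ℚ) (N : ℕ) :
    homogeneousComponent N (a * x) = if p ≤ N then a * homogeneousComponent (N - p) x else 0 := by
  have h : ∀ q, homogeneousComponent N (a * homogeneousComponent q x) =
      if p ≤ N ∧ q = N - p then a * homogeneousComponent (N - p) x else 0 := fun q => by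
    rw [homogeneousComponent_of_mem (ha.mul (homogeneousComponent_isHomogeneous q x))]
    by_cases h : p ≤ N ∧ q = N - p
    · rw [if_pos h, if_pos (by omega), h.2]
    · rw [if_neg h, if_neg (by omega)]
  conv_lhs => rw [← sum_homogeneousComponent x]
  rw [Finset.mul_sum, map_sum, Finset.sum_congr rfl fun q _ => h q]
  split_ifs with hp
  · simp only [hp, true_and, Finset.sum_ite_eq', Finset.mem_range, ite_eq_left_iff, not_lt]
    intro hN
    rw [homogeneousComponent_eq_zero _ _ (by omega), mul_zero]
  · simp [hp]

/-- Every homogeneous component of an element of `gr I` is the leading part of an element of `I`. -/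
theorem exists_mem_of_mem_grIdeal {I : Ideal (MvPolynomial σ ℚ)} {h : MvPolynomial σ ℚ}
    (hh : h ∈ grIdeal I) : ∀ N, ∃ f ∈ I, (∀ m, N < m → homogeneousComponent m f = 0) ∧
      homogeneousComponent N f = homogeneousComponent N h := by
  have hadd : ∀ x y : MvPolynomial σ ℚ,
      (∀ N, ∃ f ∈ I, (∀ m, N < m → homogeneousComponent m f = 0) ∧
        homogeneousComponent N f = homogeneousComponent N x) →
      (∀ N, ∃ f ∈ I, (∀ m, N < m → homogeneousComponent m f = 0) ∧
        homogeneousComponent N f = homogeneousComponent N y) →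
      (∀ N, ∃ f ∈ I, (∀ m, N < m → homogeneousComponent m f = 0) ∧
        homogeneousComponent N f = homogeneousComponent N (x + y)) := by
    intro x y hx hy N
    obtain ⟨f, hf, hf1, hf2⟩ := hx N
    obtain ⟨g, hg, hg1, hg2⟩ := hy N
    exact ⟨f + g, Ideal.add_mem _ hf hg, fun m hm => by rw [map_add, hf1 m hm, hg1 m hm, add_zero],
      by rw [map_add, map_add, hf2, hg2]⟩
  have hzero : ∀ N, ∃ f ∈ I, (∀ m, N < m → homogeneousComponent m f = 0) ∧
      homogeneousComponent N f = homogeneousComponent N (0 : MvPolynomial σ ℚ) :=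
    fun N => ⟨0, Ideal.zero_mem _, fun m _ => map_zero _, rfl⟩
  induction hh using Submodule.span_induction with
  | mem h hh =>
    obtain ⟨f, hf, -, rfl⟩ := hh
    intro N
    rw [topComponent, homogeneousComponent_of_mem (homogeneousComponent_isHomogeneous _ f)]
    split_ifs with hN
    · exact ⟨f, hf, fun m hm => homogeneousComponent_eq_zero _ _ (hN ▸ hm), by rw [hN]⟩
    · exact ⟨0, Ideal.zero_mem _, fun m _ => map_zero _, map_zero _⟩
  | zero => exact hzero
  | add x y _ _ hx hy => exact hadd x y hx hy
  | smul a x _ hx =>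
    rw [← sum_homogeneousComponent a, Finset.sum_smul]
    refine Finset.sum_induction _ _ hadd hzero fun p _ N => ?_
    have ha := homogeneousComponent_isHomogeneous p a
    rw [smul_eq_mul, homogeneousComponent_homogeneous_mul ha]
    split_ifs with hp
    · obtain ⟨f, hf, hf1, hf2⟩ := hx (N - p)
      refine ⟨homogeneousComponent p a * f, Ideal.mul_mem_left _ _ hf, fun m hm => ?_, ?_⟩
      · rw [homogeneousComponent_homogeneous_mul ha, if_pos (by omega), hf1 _ (by omega), mul_zero]
      · rw [homogeneousComponent_homogeneous_mul ha, if_pos hp, hf2]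
    · exact ⟨0, Ideal.zero_mem _, fun m _ => map_zero _, map_zero _⟩

/-- A linear projection onto `gr I` that preserves degrees. -/
structure IsGradedProjection (I : Ideal (MvPolynomial σ ℚ))
    (π : MvPolynomial σ ℚ →ₗ[ℚ] MvPolynomial σ ℚ) : Prop where
  mem : ∀ f, π f ∈ grIdeal I
  eq_self : ∀ f ∈ grIdeal I, π f = f
  isHomogeneous : ∀ m f, f.IsHomogeneous m → (π f).IsHomogeneous m

theorem exists_isGradedProjection (I : Ideal (MvPolynomial σ ℚ)) :
    ∃ π, IsGradedProjection I π := by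
  let K : ℕ → Submodule ℚ (MvPolynomial σ ℚ) := fun m =>
    (grIdeal I).restrictScalars ℚ ⊓ homogeneousSubmodule σ ℚ m
  have hp : ∀ m, ∃ p : MvPolynomial σ ℚ →ₗ[ℚ] K m, p ∘ₗ (K m).subtype = LinearMap.id := fun m =>
    LinearMap.exists_leftInverse_of_injective _ (K m).ker_subtype
  choose p hp using hp
  let π : MvPolynomial σ ℚ →ₗ[ℚ] MvPolynomial σ ℚ :=
    (basisMonomials σ ℚ).constr ℚ fun e => (p e.degree (monomial e 1) : MvPolynomial σ ℚ)
  have hπ : ∀ e c, π (monomial e c) = p e.degree (monomial e c) := fun e c => by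
    have h1 : monomial e c = c • basisMonomials σ ℚ e := by simp [smul_monomial]
    rw [h1, map_smul, Module.Basis.constr_basis]
    simp
  have hπ' : ∀ m f, f.IsHomogeneous m → π f = p m f := fun m f hf => by
    conv_lhs => rw [f.as_sum]
    conv_rhs => rw [f.as_sum]
    rw [map_sum, map_sum, AddSubmonoidClass.coe_finsetSum]
    refine Finset.sum_congr rfl fun e he => ?_
    rw [hπ]
    rw [show e.degree = m from (congrArg (· e) Finsupp.degree_eq_weight_one).trans
      (hf (mem_support_iff.1 he))]
  have hsum : ∀ f, π f = ∑ m ∈ Finset.range (f.totalDegree + 1),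
      (p m (homogeneousComponent m f) : MvPolynomial σ ℚ) := fun f => by
    conv_lhs => rw [← sum_homogeneousComponent f, map_sum]
    exact Finset.sum_congr rfl fun m _ => hπ' m _ (homogeneousComponent_isHomogeneous m f)
  refine ⟨π, fun f => ?_, fun f hf => ?_, fun m f hf => ?_⟩
  · rw [hsum]
    exact Ideal.sum_mem _ fun m _ => (p m _).2.1
  · rw [hsum]
    conv_rhs => rw [← sum_homogeneousComponent f]
    refine Finset.sum_congr rfl fun m _ => ?_
    have := LinearMap.congr_fun (hp m) ⟨homogeneousComponent m f,
      homogeneousComponent_mem_grIdeal hf m, homogeneousComponent_isHomogeneous m f⟩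
    exact congrArg Subtype.val this
  · rw [hπ' m f hf]
    exact (p m f).2.2

namespace IsGradedProjection

variable {I : Ideal (MvPolynomial σ ℚ)} {π : MvPolynomial σ ℚ →ₗ[ℚ] MvPolynomial σ ℚ}

theorem homogeneousComponent_apply (hπ : IsGradedProjection I π) (m : ℕ) (f : MvPolynomial σ ℚ) :
    homogeneousComponent m (π f) = π (homogeneousComponent m f) := by
  conv_lhs => rw [← sum_homogeneousComponent f, map_sum, map_sum]
  have h : ∀ q, homogeneousComponent m (π (homogeneousComponent q f)) =
      if m = q then π (homogeneousComponent m f) else 0 := fun q => by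
    rw [homogeneousComponent_of_mem
      (hπ.isHomogeneous q _ (homogeneousComponent_isHomogeneous q f))]
    split_ifs with h
    · rw [h]
    · rfl
  rw [Finset.sum_congr rfl fun q _ => h q, Finset.sum_ite_eq]
  split_ifs with hm
  · rfl
  · rw [homogeneousComponent_eq_zero _ _ (by simpa using hm), map_zero]

theorem mem_of_sub_mem (hπ : IsGradedProjection I π) {f : MvPolynomial σ ℚ} (hf : f - π f ∈ I) :
    f ∈ grIdeal I := by
  have h0 : π (f - π f) = 0 := by rw [map_sub, hπ.eq_self _ (hπ.mem f), sub_self]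
  suffices h : f - π f = 0 by
    rw [sub_eq_zero.1 h]
    exact hπ.mem f
  by_contra hne
  -- The top component of `f - π f` lies in `gr I`, so `π` fixes it; but `π` also kills it.
  have h1 : topComponent (f - π f) ∈ grIdeal I := Ideal.subset_span ⟨_, hf, hne, rfl⟩
  have h2 : topComponent (f - π f) = 0 := by
    rw [← hπ.eq_self _ h1, topComponent, ← hπ.homogeneousComponent_apply, h0, map_zero]
  obtain ⟨m, hm, hdeg⟩ := Finset.exists_mem_eq_sup _ (support_nonempty.2 hne)
    fun m : σ →₀ ℕ => m.sum fun _ e => e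
  have h3 := congrArg (coeff m) h2
  rw [topComponent, coeff_homogeneousComponent, coeff_zero] at h3
  exact mem_support_iff.1 hm ((if_pos hdeg.symm).symm.trans h3)

theorem exists_sub_mem (hπ : IsGradedProjection I π) :
    ∀ (N : ℕ) (f : MvPolynomial σ ℚ), (∀ m, N ≤ m → homogeneousComponent m f = 0) →
      ∃ g, f - (g - π g) ∈ I
  | 0, f, hf => by
    refine ⟨0, ?_⟩
    rw [← sum_homogeneousComponent f, Finset.sum_eq_zero fun m _ => hf m (Nat.zero_le m)]
    simp
  | N + 1, f, hf => by
    let t := homogeneousComponent N f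
    have ht : t.IsHomogeneous N := homogeneousComponent_isHomogeneous N f
    obtain ⟨i, hi, hi1, hi2⟩ := exists_mem_of_mem_grIdeal (hπ.mem t) N
    rw [homogeneousComponent_eq_self (hπ.isHomogeneous N t ht)] at hi2
    obtain ⟨g, hg⟩ := exists_sub_mem hπ N (f - (t - π t) - i) fun m hm => by
      rw [map_sub, map_sub, map_sub, homogeneousComponent_of_mem ht,
        homogeneousComponent_of_mem (hπ.isHomogeneous N t ht)]
      rcases hm.eq_or_lt with rfl | hm
      · rw [if_pos rfl, if_pos rfl, hi2]
        simp [t]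
      · rw [if_neg hm.ne', if_neg hm.ne', hf m hm, hi1 m hm]
        simp
    refine ⟨g + t, ?_⟩
    have h := Ideal.add_mem _ hg hi
    rw [map_add]
    convert h using 1
    ring

/-- Subtracting a graded projection onto `gr I` induces an isomorphism from the quotient by `gr I`
to the quotient by `I`. -/
theorem exists_linearEquiv (hπ : IsGradedProjection I π) :
    ∃ e : (MvPolynomial σ ℚ ⧸ (grIdeal I).restrictScalars ℚ) ≃ₗ[ℚ]
        (MvPolynomial σ ℚ ⧸ I.restrictScalars ℚ),
      ∀ f, e (Submodule.Quotient.mk f) = Submodule.Quotient.mk (f - π f) := by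
  let ψ : MvPolynomial σ ℚ →ₗ[ℚ] (MvPolynomial σ ℚ ⧸ I.restrictScalars ℚ) :=
    (I.restrictScalars ℚ).mkQ ∘ₗ (LinearMap.id - π)
  have hψ : ∀ f, ψ f = Submodule.Quotient.mk (f - π f) := fun f => rfl
  have hker : (grIdeal I).restrictScalars ℚ ≤ LinearMap.ker ψ := fun f hf => by
    rw [LinearMap.mem_ker, hψ, hπ.eq_self f hf, sub_self, Submodule.Quotient.mk_zero]
  refine ⟨LinearEquiv.ofBijective (Submodule.liftQ _ ψ hker) ⟨?_, ?_⟩, fun f => rfl⟩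
  · rw [← LinearMap.ker_eq_bot]
    refine Submodule.ker_liftQ_eq_bot _ _ _ fun f hf => hπ.mem_of_sub_mem ?_
    rw [LinearMap.mem_ker, hψ, Submodule.Quotient.mk_eq_zero] at hf
    exact hf
  · intro x
    obtain ⟨f, rfl⟩ := Submodule.Quotient.mk_surjective _ x
    obtain ⟨g, hg⟩ := hπ.exists_sub_mem (f.totalDegree + 1) f fun m hm =>
      homogeneousComponent_eq_zero _ _ hm
    refine ⟨Submodule.Quotient.mk g, ?_⟩
    exact ((Submodule.Quotient.eq _).2 hg).symm

/-- Averaging a graded projection over a finite group that acts by degree preserving maps and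
preserves `gr I` makes it equivariant. -/
theorem exists_equivariant {G : Type*} [Group G] [Finite G]
    (ρ : Representation ℚ G (MvPolynomial σ ℚ))
    (hmem : ∀ g, ∀ f ∈ grIdeal I, ρ g f ∈ grIdeal I)
    (hhom : ∀ g m f, f.IsHomogeneous m → (ρ g f).IsHomogeneous m)
    (hπ : IsGradedProjection I π) :
    ∃ π', IsGradedProjection I π' ∧ ∀ g f, π' (ρ g f) = ρ g (π' f) := by
  have := Fintype.ofFinite G
  let c : ℚ := (Fintype.card G : ℚ)⁻¹
  have hc : c * Fintype.card G = 1 := inv_mul_cancel₀ (by exact_mod_cast Fintype.card_ne_zero)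
  let π' : MvPolynomial σ ℚ →ₗ[ℚ] MvPolynomial σ ℚ := c • ∑ g : G, ρ g ∘ₗ π ∘ₗ ρ g⁻¹
  have hπ' : ∀ f, π' f = c • ∑ g : G, ρ g (π (ρ g⁻¹ f)) := fun f => by simp [π']
  refine ⟨π', ⟨fun f => ?_, fun f hf => ?_, fun m f hf => ?_⟩, fun g f => ?_⟩
  · rw [hπ']
    exact Submodule.smul_of_tower_mem _ _ (Ideal.sum_mem _ fun g _ => hmem g _ (hπ.mem _))
  · have h : ∀ g, ρ g (π (ρ g⁻¹ f)) = f := fun g => by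
      rw [hπ.eq_self _ (hmem _ _ hf), Representation.self_inv_apply]
    rw [hπ', Finset.sum_congr rfl fun g _ => h g, Finset.sum_const, Finset.card_univ,
      ← Nat.cast_smul_eq_nsmul ℚ, smul_smul, hc, one_smul]
  · rw [hπ']
    exact (homogeneousSubmodule σ ℚ m).smul_mem _ (Submodule.sum_mem _ fun g _ =>
      hhom _ _ _ (hπ.isHomogeneous _ _ (hhom _ _ _ hf)))
  · rw [hπ', hπ', map_smul, map_sum]
    congr 1
    rw [← Equiv.sum_comp (Equiv.mulLeft g)]
    refine Finset.sum_congr rfl fun h _ => ?_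
    simp [mul_inv_rev, map_mul, Module.End.mul_apply]

end IsGradedProjection

end Graded

/-! ### Standard monomials -/

section Standard

variable {σ : Type*} [LinearOrder σ] [WellFoundedGT σ]

theorem monomial_mem_lexInitialIdeal_iff {K : Ideal (MvPolynomial σ ℚ)} {m : σ →₀ ℕ} :
    monomial m (1 : ℚ) ∈ lexInitialIdeal K ↔
      ∃ f ∈ K, f ≠ 0 ∧ (MonomialOrder.lex (σ := σ)).degree f ≤ m := by
  have h : lexInitialIdeal K = Ideal.span ((fun s => monomial s (1 : ℚ)) ''
      {a | ∃ f ∈ K, f ≠ 0 ∧ a = (MonomialOrder.lex (σ := σ)).degree f}) := by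
    unfold lexInitialIdeal
    congr 1
    ext g
    constructor
    · rintro ⟨f, hf, hf0, rfl⟩
      exact ⟨_, ⟨f, hf, hf0, rfl⟩, rfl⟩
    · rintro ⟨_, ⟨f, hf, hf0, rfl⟩, rfl⟩
      exact ⟨f, hf, hf0, rfl⟩
  rw [h, mem_ideal_span_monomial_image]
  classical
  simp only [support_monomial, one_ne_zero, if_false, Finset.mem_singleton, forall_eq]
  constructor
  · rintro ⟨_, ⟨f, hf, hf0, rfl⟩, hm⟩
    exact ⟨f, hf, hf0, hm⟩
  · rintro ⟨f, hf, hf0, hm⟩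
    exact ⟨_, ⟨f, hf, hf0, rfl⟩, hm⟩

theorem eq_zero_of_mem_of_support_subset {K : Ideal (MvPolynomial σ ℚ)} {f : MvPolynomial σ ℚ}
    (hf : f ∈ K) (hs : ∀ m ∈ f.support, monomial m (1 : ℚ) ∉ lexInitialIdeal K) : f = 0 := by
  by_contra h0
  exact hs _ (MonomialOrder.degree_mem_support h0)
    (monomial_mem_lexInitialIdeal_iff.2 ⟨f, hf, h0, le_rfl⟩)

theorem exists_sub_mem_of_forall_notMem {K : Ideal (MvPolynomial σ ℚ)} {S : Set (σ →₀ ℕ)}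
    (hS : ∀ m ∉ S, monomial m (1 : ℚ) ∈ lexInitialIdeal K) (f : MvPolynomial σ ℚ) :
    ∃ r ∈ restrictSupport ℚ S, f - r ∈ K := by
  obtain ⟨g, r, hfr, -, hr⟩ := (MonomialOrder.lex (σ := σ)).div_set
    (B := {b | b ∈ K ∧ b ≠ 0})
    (fun b hb => (isUnit_iff_ne_zero).2 (MonomialOrder.leadingCoeff_ne_zero_iff.2 hb.2)) f
  refine ⟨r, fun m hm => ?_, ?_⟩
  · by_contra hmS
    obtain ⟨b, hb, hb0, hbm⟩ := monomial_mem_lexInitialIdeal_iff.1 (hS m hmS)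
    exact hr m hm b ⟨hb, hb0⟩ hbm
  · rw [hfr, add_sub_cancel_right, Finsupp.linearCombination_apply]
    exact Ideal.sum_mem _ fun b _ => Ideal.mul_mem_left _ _ b.2.1

/-- Upper bounds from leading monomials in `J ≤ K` and a lower bound on the dimension of the
quotient by `K` determine the standard monomials of `K`, and force `J = K`. -/
theorem eq_and_isLexStandardMonomialBasis {J K : Ideal (MvPolynomial σ ℚ)} (hJK : J ≤ K)
    {S : Set (σ →₀ ℕ)} (hfin : S.Finite)
    (hS : ∀ m ∉ S, monomial m (1 : ℚ) ∈ lexInitialIdeal J)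
    (hcard : S.ncard ≤ Module.finrank ℚ (MvPolynomial σ ℚ ⧸ K)) :
    K = J ∧ IsLexStandardMonomialBasis K S := by
  have hle : lexInitialIdeal J ≤ lexInitialIdeal K :=
    Ideal.span_mono fun g ⟨f, hf, h⟩ => ⟨f, hJK hf, h⟩
  let T : Set (σ →₀ ℕ) := {m | monomial m (1 : ℚ) ∉ lexInitialIdeal K}
  have hTS : T ⊆ S := fun m hm => by
    by_contra h
    exact hm (hle (hS m h))
  let q : MvPolynomial σ ℚ →ₗ[ℚ] (MvPolynomial σ ℚ ⧸ K) := (Ideal.Quotient.mkₐ ℚ K).toLinearMap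
  have hq : ∀ f, q f = 0 ↔ f ∈ K := fun f => Ideal.Quotient.eq_zero_iff_mem
  let b : T → MvPolynomial σ ℚ := fun m => monomial (m : σ →₀ ℕ) (1 : ℚ)
  have hspan : Submodule.span ℚ (Set.range b) = restrictSupport ℚ T := by
    rw [restrictSupport_eq_span, Set.image_eq_range]
  have hind : LinearIndependent ℚ (q ∘ b) := by
    refine LinearIndependent.map ((basisMonomials σ ℚ).linearIndependent.comp _
      Subtype.val_injective) ?_
    have hb : ((basisMonomials σ ℚ : (σ →₀ ℕ) → MvPolynomial σ ℚ) ∘ Subtype.val : T → _) = b := by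
      funext m
      simp [b]
    rw [hb, hspan, Submodule.disjoint_def]
    exact fun f hf hf' => eq_zero_of_mem_of_support_subset ((hq f).1 hf') fun m hm => hf hm
  have htop : Submodule.span ℚ (Set.range (q ∘ b)) = ⊤ := by
    rw [Set.range_comp, ← Submodule.map_span, hspan, eq_top_iff]
    intro x _
    obtain ⟨f, rfl⟩ := Ideal.Quotient.mk_surjective x
    obtain ⟨r, hr, hfr⟩ := exists_sub_mem_of_forall_notMem (K := K) (S := T)
      (fun m hm => not_not.1 hm) f
    refine ⟨r, hr, ?_⟩
    rw [← hq, map_sub, sub_eq_zero] at hfr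
    exact hfr.symm
  have hTcard : T.ncard = Module.finrank ℚ (MvPolynomial σ ℚ ⧸ K) := by
    rw [Module.finrank_eq_nat_card_basis (Module.Basis.mk hind htop.ge), Set.ncard]
    rfl
  have hST : T = S := Set.eq_of_subset_of_ncard_le hTS (hcard.trans hTcard.ge) hfin
  refine ⟨le_antisymm (fun f hf => ?_) hJK, hST.symm, ?_⟩
  · obtain ⟨r, hr, hfr⟩ := exists_sub_mem_of_forall_notMem hS f
    have hrK : r ∈ K := by
      have := Ideal.sub_mem _ hf (hJK hfr)
      rwa [sub_sub_cancel] at this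
    have hr0 : r = 0 := eq_zero_of_mem_of_support_subset hrK fun m hm =>
      (hST ▸ hr hm : m ∈ T)
    rwa [hr0, sub_zero] at hfr
  · rw [← hST]
    exact ⟨hind, htop⟩

end Standard

/-! ### Functions on a finite set of points -/

section Points

variable {σ : Type*}

theorem exists_aeval_eq {Z : Set (σ → ℚ)} (hZ : Z.Finite) (z : σ → ℚ) :
    ∃ f : MvPolynomial σ ℚ, aeval z f = 1 ∧ ∀ w ∈ Z, w ≠ z → aeval w f = 0 := by
  classical
  have h : ∀ w : σ → ℚ, ∃ f : MvPolynomial σ ℚ, aeval z f = 1 ∧ (w ≠ z → aeval w f = 0) := by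
    intro w
    by_cases hw : w = z
    · exact ⟨1, by simp, fun h => absurd hw h⟩
    · obtain ⟨v, hv⟩ := Function.ne_iff.1 hw
      refine ⟨C (z v - w v)⁻¹ * (X v - C (w v)), ?_, fun _ => ?_⟩
      · have : z v - w v ≠ 0 := sub_ne_zero.2 (Ne.symm hv)
        simp [this]
      · simp
  choose f hf1 hf2 using h
  refine ⟨∏ w ∈ hZ.toFinset, f w, by simp [map_prod, hf1], fun w hw hwz => ?_⟩
  rw [map_prod]
  exact Finset.prod_eq_zero (hZ.mem_toFinset.2 hw) (hf2 w hwz)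

theorem finrank_quotient_vanishingIdeal {Z : Set (σ → ℚ)} (hZ : Z.Finite) :
    Module.finrank ℚ (MvPolynomial σ ℚ ⧸ (vanishingIdeal ℚ Z).restrictScalars ℚ) = Z.ncard := by
  classical
  have := hZ.fintype
  let ev : MvPolynomial σ ℚ →ₗ[ℚ] (Z → ℚ) :=
    LinearMap.pi fun z => (aeval (z : σ → ℚ) : MvPolynomial σ ℚ →ₐ[ℚ] ℚ).toLinearMap
  have hker : (vanishingIdeal ℚ Z).restrictScalars ℚ = LinearMap.ker ev := by
    ext f
    rw [Submodule.restrictScalars_mem, mem_vanishingIdeal_iff, LinearMap.mem_ker, funext_iff]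
    exact ⟨fun h z => h z z.2, fun h z hz => h ⟨z, hz⟩⟩
  have hsurj : Function.Surjective ev := by
    intro φ
    choose f hf1 hf2 using fun z : Z => exists_aeval_eq hZ (z : σ → ℚ)
    refine ⟨∑ z, φ z • f z, funext fun w => ?_⟩
    have : ∀ z : Z, φ z • aeval (w : σ → ℚ) (f z) = if z = w then φ w else 0 := fun z => by
      split_ifs with h
      · rw [h, hf1, smul_eq_mul, mul_one]
      · rw [hf2 z w w.2 fun h' => h (Subtype.ext h'.symm), smul_zero]
    change aeval (w : σ → ℚ) (∑ z, φ z • f z) = _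
    rw [map_sum]
    simp only [map_smul, this]
    simp
  rw [hker, (ev.quotKerEquivOfSurjective hsurj).finrank_eq, Module.finrank_fintype_fun_eq_card,
    ← Nat.card_eq_fintype_card, Set.ncard]
  rfl

end Points

/-! ### Generating functions of symmetric polynomials -/

section GeneratingFunctions

open Finset

theorem natDegree_prod_one_sub_le {ι S : Type*} [CommRing S] (s : Finset ι) (y : ι → S) :
    (∏ j ∈ s, (1 - Polynomial.C (y j) * Polynomial.X)).natDegree ≤ #s := by
  refine (Polynomial.natDegree_prod_le _ _).trans ?_
  rw [card_eq_sum_ones]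
  refine sum_le_sum fun j _ => ?_
  refine (Polynomial.natDegree_sub_le _ _).trans (max_le (by simp) ?_)
  exact (Polynomial.natDegree_C_mul_le _ _).trans Polynomial.natDegree_X_le

theorem reflect_prod_one_sub {ι S : Type*} [CommRing S] (s : Finset ι) (y : ι → S) :
    Polynomial.reflect #s (∏ j ∈ s, (1 - Polynomial.C (y j) * Polynomial.X)) =
      ∏ j ∈ s, (Polynomial.X - Polynomial.C (y j)) := by
  classical
  induction s using Finset.induction_on with
  | empty => simp [Polynomial.reflect_one]
  | insert a s ha ih =>
    rw [prod_insert ha, prod_insert ha, card_insert_of_notMem ha, add_comm (#s),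
      Polynomial.reflect_mul _ _ _ (natDegree_prod_one_sub_le s y), ih]
    · congr 1
      rw [Polynomial.reflect_sub, Polynomial.reflect_C_mul, Polynomial.reflect_one_X,
        Polynomial.reflect_one, pow_one, mul_one]
    · simpa using natDegree_prod_one_sub_le {a} y

variable {ι κ S : Type*} [Fintype ι] [Fintype κ] [CommRing S] [Algebra ℚ S]

/-- The polynomial `∏ (1 - y_j T)`. -/
def ePoly (y : ι → S) : Polynomial S := ∏ j, (1 - Polynomial.C (y j) * Polynomial.X)

/-- The generating function of the values `h_r(y)`. -/
def hSeries [DecidableEq ι] (y : ι → S) : PowerSeries S :=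
  PowerSeries.mk fun r => aeval y (hsymm ι ℚ r)

theorem coeff_ePoly (y : ι → S) (r : ℕ) :
    (ePoly y).coeff r = (-1) ^ r * aeval y (esymm ι ℚ r) := by
  classical
  have h : ∀ t : Finset ι, ∏ j ∈ t, -(Polynomial.C (y j) * Polynomial.X) =
      Polynomial.C ((-1) ^ #t * ∏ j ∈ t, y j) * Polynomial.X ^ #t := fun t => by
    rw [prod_neg, prod_mul_distrib, prod_const, ← map_prod]
    simp [mul_assoc]
  simp only [ePoly, sub_eq_add_neg, prod_one_add, h, Polynomial.finsetSum_coeff,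
    Polynomial.coeff_C_mul_X_pow]
  rw [← sum_filter, aeval_esymm_eq_multiset_esymm, esymm_map_val, mul_sum,
    powersetCard_eq_filter]
  refine sum_congr (by simp [eq_comm]) fun t ht => ?_
  rw [(mem_filter.1 ht).2]

theorem hsymm_eq_sum_monomial [DecidableEq ι] (r : ℕ) :
    hsymm ι ℚ r = ∑ l ∈ finsuppAntidiag univ r, monomial l 1 := by
  rw [hsymm]
  refine sum_bij' (fun s _ => Multiset.toFinsupp (s : Multiset ι))
    (fun l hl => ⟨Finsupp.toMultiset l, ?_⟩) ?_ ?_ ?_ ?_ ?_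
  · rw [mem_finsuppAntidiag'] at hl
    rw [Finsupp.card_toMultiset]
    exact hl.1
  · intro s _
    rw [mem_finsuppAntidiag']
    refine ⟨?_, subset_univ _⟩
    have := Finsupp.card_toMultiset (Multiset.toFinsupp (s : Multiset ι))
    rw [Multiset.toFinsupp_toMultiset] at this
    exact this.symm.trans s.2
  · intro l _
    exact mem_univ _
  · intro s _
    exact Subtype.ext (Multiset.toFinsupp_toMultiset _)
  · intro l _
    exact Finsupp.toMultiset_toFinsupp l
  · intro s _
    have h : ∀ m : Multiset ι, (m.map (X : ι → MvPolynomial ι ℚ)).prod =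
        monomial (Multiset.toFinsupp m) 1 := fun m => by
      induction m using Multiset.induction_on with
      | empty => simp
      | cons a m ih =>
        rw [Multiset.map_cons, Multiset.prod_cons, ih, ← Multiset.singleton_add, map_add,
          Multiset.toFinsupp_singleton, X, monomial_mul, one_mul]
    exact h s

theorem hSeries_mul_ePoly [DecidableEq ι] (y : ι → S) :
    hSeries y * (ePoly y : PowerSeries S) = 1 := by
  have h1 : hSeries y = ∏ j, PowerSeries.mk fun m => y j ^ m := by
    ext r
    rw [PowerSeries.coeff_prod, hSeries, PowerSeries.coeff_mk, hsymm_eq_sum_monomial, map_sum]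
    refine sum_congr rfl fun l _ => ?_
    simp [aeval_monomial, Finsupp.prod_fintype]
  have h2 : (ePoly y : PowerSeries S) = ∏ j, (1 - PowerSeries.C (y j) * PowerSeries.X) := by
    rw [ePoly, ← Polynomial.coeToPowerSeries.ringHom_apply, map_prod]
    simp
  rw [h1, h2, ← prod_mul_distrib]
  refine prod_eq_one fun j _ => ?_
  have h := congrArg (PowerSeries.rescale (y j)) (PowerSeries.mk_one_mul_one_sub_eq_one S)
  rw [map_mul, map_sub, map_one, PowerSeries.rescale_X, PowerSeries.rescale_mk] at h
  simpa using h

theorem coeff_ePoly_mul_hSeries [DecidableEq κ] (x : ι → S) (y : κ → S) (r : ℕ) :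
    PowerSeries.coeff r ((ePoly x : PowerSeries S) * hSeries y) =
      (-1) ^ r * ∑ b ∈ range (r + 1),
        (-1) ^ b * aeval x (esymm ι ℚ (r - b)) * aeval y (hsymm κ ℚ b) := by
  rw [mul_comm, PowerSeries.coeff_mul, Nat.sum_antidiagonal_eq_sum_range_succ
    (fun b a => PowerSeries.coeff b (hSeries y) * PowerSeries.coeff a (ePoly x : PowerSeries S)),
    mul_sum]
  refine sum_congr rfl fun b hb => ?_
  have hb' : b ≤ r := Nat.lt_succ_iff.1 (mem_range.1 hb)
  rw [Polynomial.coeff_coe, coeff_ePoly, hSeries, PowerSeries.coeff_mk]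
  have h : (-1 : S) ^ (r - b) = (-1) ^ r * (-1) ^ b := by
    rw [← pow_add, show r + b = r - b + 2 * b by omega, pow_add, pow_mul, neg_one_sq, one_pow,
      mul_one]
  rw [h]
  ring

/-- If the `y_j` are some of the `x_i`, then `∏ (1 - x_i T) / ∏ (1 - y_j T)` is a polynomial whose
degree is at most the number of remaining `x_i`. -/
theorem coeff_ePoly_mul_hSeries_eq_zero [DecidableEq κ] (x : ι → S) (e : κ → ι)
    (he : Function.Injective e) {r : ℕ} (hr : Fintype.card ι - Fintype.card κ < r) :
    PowerSeries.coeff r ((ePoly x : PowerSeries S) * hSeries (x ∘ e)) = 0 := by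
  classical
  have h : ePoly x = (∏ i ∈ (univ.image e)ᶜ, (1 - Polynomial.C (x i) * Polynomial.X)) *
      ePoly (x ∘ e) := by
    rw [ePoly, ePoly, ← prod_compl_mul_prod (univ.image e), prod_image he.injOn]
    rfl
  rw [h, Polynomial.coe_mul, mul_assoc, mul_comm (ePoly (x ∘ e) : PowerSeries S),
    hSeries_mul_ePoly, mul_one, Polynomial.coeff_coe]
  refine Polynomial.coeff_eq_zero_of_natDegree_lt ((natDegree_prod_one_sub_le _ _).trans_lt ?_)
  rwa [card_compl, card_image_of_injective _ he]

/-- If `∏ (1 - x_i T) / ∏ (1 - y_j T)` has no terms of degree above `#ι - #κ`, then its reversal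
is a polynomial quotient of `∏ (T - x_i)` by `∏ (T - y_j)`. -/
theorem prod_X_sub_C_dvd [DecidableEq κ] (x : ι → S) (y : κ → S)
    (hcard : Fintype.card κ ≤ Fintype.card ι)
    (h : ∀ r, Fintype.card ι - Fintype.card κ < r →
      PowerSeries.coeff r ((ePoly x : PowerSeries S) * hSeries y) = 0) :
    ∏ j, (Polynomial.X - Polynomial.C (y j)) ∣ ∏ i, (Polynomial.X - Polynomial.C (x i)) := by
  set N := Fintype.card ι - Fintype.card κ with hN
  let Q : Polynomial S :=
    PowerSeries.trunc (N + 1) ((ePoly x : PowerSeries S) * hSeries y)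
  have hQ : (Q : PowerSeries S) = (ePoly x : PowerSeries S) * hSeries y := by
    ext r
    rw [Polynomial.coeff_coe, PowerSeries.coeff_trunc]
    split_ifs with hr
    · rfl
    · exact (h r (by omega)).symm
  have hQd : Q.natDegree ≤ N := Nat.lt_succ_iff.1 (PowerSeries.natDegree_trunc_lt _ _)
  have hmul : ePoly x = ePoly y * Q := by
    apply Polynomial.coe_injective S
    rw [Polynomial.coe_mul, hQ, mul_comm, mul_assoc, hSeries_mul_ePoly, mul_one]
  refine ⟨Polynomial.reflect N Q, ?_⟩
  rw [← reflect_prod_one_sub univ x, ← reflect_prod_one_sub univ y,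
    ← Polynomial.reflect_mul _ _ (natDegree_prod_one_sub_le univ y) hQd, card_univ, card_univ,
    show Fintype.card κ + N = Fintype.card ι by omega]
  exact congrArg _ hmul

theorem prod_sub_eq_sum (x : S) (y : ι → S) :
    ∏ j, (x - y j) = ∑ b ∈ range (Fintype.card ι + 1),
      (-1) ^ b * x ^ (Fintype.card ι - b) * aeval y (esymm ι ℚ b) := by
  have h := congrArg (Polynomial.eval x) (Multiset.prod_X_sub_X_eq_sum_esymm (univ.val.map y))
  rw [Multiset.map_map, Polynomial.eval_multiset_prod, Multiset.map_map,
    Polynomial.eval_finsetSum] at h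
  simp only [Multiset.card_map, card_val, card_univ, ← aeval_esymm_eq_multiset_esymm ι ℚ] at h
  refine Eq.trans ?_ (h.trans (sum_congr rfl fun b _ => ?_))
  · rw [prod_eq_multiset_prod]
    congr 2
    funext j
    simp
  · rw [Polynomial.eval_mul, Polynomial.eval_C_mul, Polynomial.eval_X_pow, Polynomial.eval_pow,
      Polynomial.eval_neg, Polynomial.eval_one]
    ring

end GeneratingFunctions

/-! ### The ideal `J` lies in the associated graded ideal -/

section LowerBound

variable {n k d : ℕ}

theorem esymm_isHomogeneous (ι : Type*) [Fintype ι] (r : ℕ) : (esymm ι ℚ r).IsHomogeneous r := by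
  refine IsHomogeneous.sum _ _ _ fun t ht => ?_
  have h := IsHomogeneous.prod t (fun i => (X i : MvPolynomial ι ℚ)) (fun _ => 1)
    fun i _ => isHomogeneous_X _ i
  simpa [(Finset.mem_powersetCard.1 ht).2] using h

theorem hsymm_isHomogeneous (ι : Type*) [Fintype ι] [DecidableEq ι] (r : ℕ) :
    (hsymm ι ℚ r).IsHomogeneous r := by
  rw [hsymm_eq_sum_monomial]
  refine IsHomogeneous.sum _ _ _ fun l hl => isHomogeneous_monomial _ ?_
  rw [Finset.mem_finsuppAntidiag'] at hl
  exact hl.1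

theorem ey_isHomogeneous (r : ℕ) : (ey n d r).IsHomogeneous r :=
  (esymm_isHomogeneous _ r).rename_isHomogeneous

theorem ex_isHomogeneous (r : ℕ) : (ex n d r).IsHomogeneous r :=
  (esymm_isHomogeneous _ r).rename_isHomogeneous

theorem hy_isHomogeneous (r : ℕ) : (hy n d r).IsHomogeneous r :=
  (hsymm_isHomogeneous _ r).rename_isHomogeneous

theorem aeval_ex {S : Type*} [CommRing S] [Algebra ℚ S] (z : Vars n d → S) (r : ℕ) :
    aeval z (ex n d r) = aeval (fun i => z (xv d i)) (esymm (Fin n) ℚ r) :=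
  aeval_rename _ _ _

theorem aeval_ey {S : Type*} [CommRing S] [Algebra ℚ S] (z : Vars n d → S) (r : ℕ) :
    aeval z (ey n d r) = aeval (fun j => z (yv n j)) (esymm (Fin d) ℚ r) :=
  aeval_rename _ _ _

theorem aeval_hy {S : Type*} [CommRing S] [Algebra ℚ S] (z : Vars n d → S) (r : ℕ) :
    aeval z (hy n d r) = aeval (fun j => z (yv n j)) (hsymm (Fin d) ℚ r) :=
  aeval_rename _ _ _

theorem neg_one_pow_isHomogeneous {σ : Type*} (b : ℕ) :
    ((-1) ^ b : MvPolynomial σ ℚ).IsHomogeneous 0 := by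
  simpa using isHomogeneous_C σ ((-1 : ℚ) ^ b)

theorem mem_grIdeal_of_isHomogeneous {σ : Type*} {I : Ideal (MvPolynomial σ ℚ)}
    {f : MvPolynomial σ ℚ} {r : ℕ} (hf : f ∈ I) (hr : f.IsHomogeneous r) : f ∈ grIdeal I := by
  rw [← homogeneousComponent_eq_self hr]
  refine homogeneousComponent_mem_grIdeal_of_forall_lt hf fun m hm => ?_
  rw [homogeneousComponent_of_mem hr, if_neg hm.ne']

theorem idealJ_le_grIdeal (α : Fin k → ℚ) :
    idealJ n k d ≤ grIdeal (vanishingIdeal ℚ (locus n d α)) := by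
  refine Ideal.span_le.2 ?_
  rintro g ((⟨r, hr, rfl⟩ | ⟨r, hr, rfl⟩) | ⟨i, rfl⟩)
  · -- `h_r(y)` is the top component of the coefficient of `T ^ r` in the series
    -- `∏ (1 - α_a T) / ∏ (1 - y_j T)`, which is a polynomial of degree `k - d` on the locus.
    let c : ℕ → ℚ := fun b => (-1) ^ r * ((-1) ^ b * aeval α (esymm (Fin k) ℚ (r - b)))
    let f : Poly n d := ∑ b ∈ Finset.range (r + 1), C (c b) * hy n d b
    have hcomp : ∀ m, homogeneousComponent m f =
        if m ≤ r then C (c m) * hy n d m else 0 := fun m => by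
      simp only [f, map_sum, homogeneousComponent_C_mul]
      have h : ∀ b, C (c b) * homogeneousComponent m (hy n d b) =
          if m = b then C (c m) * hy n d m else 0 := fun b => by
        rw [homogeneousComponent_of_mem (hy_isHomogeneous b)]
        split_ifs with hb
        · rw [hb]
        · rw [mul_zero]
      simp only [h, Finset.sum_ite_eq, Finset.mem_range, Nat.lt_succ_iff]
    have hf : f ∈ vanishingIdeal ℚ (locus n d α) := by
      rw [mem_vanishingIdeal_iff]
      intro z hz
      choose e he using fun j => hz.1 (yv n j)
      have he' : α ∘ e = fun j => z (yv n j) := funext he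
      have hinj : Function.Injective e := fun a b hab => hz.2.1 (by
        change z (yv n a) = z (yv n b)
        rw [← he, ← he, hab])
      have h := coeff_ePoly_mul_hSeries_eq_zero α e hinj (r := r) (by simpa using hr)
      rw [coeff_ePoly_mul_hSeries, he', Finset.mul_sum] at h
      rw [← h, map_sum]
      refine Finset.sum_congr rfl fun b _ => ?_
      rw [map_mul, aeval_hy, aeval_C]
      simp only [c, eq_ratCast, Rat.cast_id]
      ring
    have h := homogeneousComponent_mem_grIdeal_of_forall_lt (r := r) hf fun m hm => by
      rw [hcomp, if_neg (not_le.2 hm)]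
    rw [hcomp, if_pos le_rfl] at h
    have hcr : c r * c r = 1 := by
      simp only [c, Nat.sub_self, esymm_zero, map_one, mul_one]
      rw [← pow_add, ← two_mul, pow_mul, neg_one_sq, one_pow, mul_one]
    have h' := Ideal.mul_mem_left _ (C (c r)) h
    rwa [← mul_assoc, ← C_mul, hcr, C_1, one_mul] at h'
  · refine mem_grIdeal_of_isHomogeneous (r := r) ?_ (IsHomogeneous.sum _ _ _ fun b hb => ?_)
    · rw [mem_vanishingIdeal_iff]
      intro z hz
      have hsub : ∀ j, ∃ i, z (xv d i) = z (yv n j) := fun j =>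
        hz.2.2.symm.subset (Set.mem_range_self j)
      choose e he using hsub
      have he' : (fun i => z (xv d i)) ∘ e = fun j => z (yv n j) := funext he
      have hinj : Function.Injective e := fun a b hab => hz.2.1 (by
        change z (yv n a) = z (yv n b)
        rw [← he, ← he, hab])
      have h := coeff_ePoly_mul_hSeries_eq_zero (fun i => z (xv d i)) e hinj (r := r)
        (by simpa using hr)
      rw [coeff_ePoly_mul_hSeries, he'] at h
      have h' := (mul_eq_zero.1 h).resolve_left (pow_ne_zero _ (by norm_num))
      rw [← h', map_sum]
      refine Finset.sum_congr rfl fun b _ => ?_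
      rw [map_mul, map_mul, aeval_ex, aeval_hy, map_pow, map_neg, map_one]
    · have hb' := Nat.lt_succ_iff.1 (Finset.mem_range.1 hb)
      have h := ((neg_one_pow_isHomogeneous b).mul (ex_isHomogeneous (n := n) (d := d) (r - b))).mul
        (hy_isHomogeneous b)
      rwa [zero_add, Nat.sub_add_cancel hb'] at h
  · refine mem_grIdeal_of_isHomogeneous (r := d) ?_ (IsHomogeneous.sum _ _ _ fun b hb => ?_)
    · rw [mem_vanishingIdeal_iff]
      intro z hz
      obtain ⟨j, hj⟩ := hz.2.2.subset (Set.mem_range_self i)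
      have h := prod_sub_eq_sum (z (xv d i)) fun j => z (yv n j)
      rw [Finset.prod_eq_zero (Finset.mem_univ j) (sub_eq_zero.2 hj.symm), Fintype.card_fin] at h
      rw [h, map_sum]
      refine Finset.sum_congr rfl fun b _ => ?_
      rw [map_mul, map_mul, aeval_ey, map_pow, map_pow, map_neg, map_one, aeval_X]
    · have hb' := Nat.lt_succ_iff.1 (Finset.mem_range.1 hb)
      have h := ((neg_one_pow_isHomogeneous b).mul
        (isHomogeneous_X_pow (R := ℚ) (xv d i) (d - b))).mul (ey_isHomogeneous b)
      rwa [zero_add, Nat.sub_add_cancel hb'] at h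

end LowerBound

/-! ### Leading monomials of elements of `J` -/

section UpperBound

variable {n k d : ℕ}

theorem lexDegree_eq {σ : Type*} [LinearOrder σ] [WellFoundedGT σ] {F : MvPolynomial σ ℚ}
    {a : σ →₀ ℕ} (ha : coeff a F ≠ 0) (hF : ∀ m ∈ F.support, toLex m ≤ toLex a) :
    (MonomialOrder.lex (σ := σ)).degree F = a := by
  have h1 : MonomialOrder.lex.toSyn (MonomialOrder.lex.degree F) ≤ MonomialOrder.lex.toSyn a :=
    MonomialOrder.degree_le_iff.2 hF
  exact MonomialOrder.lex.toSyn.injective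
    (h1.antisymm (MonomialOrder.lex.le_degree (mem_support_iff.2 ha)))

theorem monomial_mem_lexInitialIdeal_of_le {σ : Type*} [LinearOrder σ] [WellFoundedGT σ]
    {K : Ideal (MvPolynomial σ ℚ)} {F : MvPolynomial σ ℚ} (hFK : F ∈ K) {a m : σ →₀ ℕ}
    (ha : coeff a F ≠ 0) (hF : ∀ b ∈ F.support, toLex b ≤ toLex a) (ham : a ≤ m) :
    monomial m (1 : ℚ) ∈ lexInitialIdeal K :=
  monomial_mem_lexInitialIdeal_iff.2
    ⟨F, hFK, fun h => ha (by rw [h, coeff_zero]), (lexDegree_eq ha hF).trans_le ham⟩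

theorem toLex_le_single {σ : Type*} [LinearOrder σ] {m : σ →₀ ℕ} {w : σ}
    (hm : ∀ v < w, m v = 0) : toLex m ≤ toLex (Finsupp.single w m.degree) := by
  classical
  have hle : m w ≤ m.degree := Finsupp.le_degree w m
  rcases hle.eq_or_lt with h | h
  · have h1 : m = Finsupp.single w m.degree := by
      have h2 : m - Finsupp.single w (m w) = 0 := by
        rw [← Finsupp.degree_eq_zero_iff]
        have h3 := congrArg Finsupp.degree
          (tsub_add_cancel_of_le (Finsupp.single_le_iff.2 (le_refl (m w))))
        rw [map_add, Finsupp.degree_single] at h3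
        omega
      rw [← h]
      have h3 := tsub_add_cancel_of_le (Finsupp.single_le_iff.2 (le_refl (m w)))
      rw [h2, zero_add] at h3
      exact h3.symm
    rw [← h1]
  · refine le_of_lt ?_
    rw [Finsupp.Lex.lt_iff]
    refine ⟨w, fun v hv => ?_, by simpa using h⟩
    rw [ofLex_toLex, ofLex_toLex, hm v hv, Finsupp.single_eq_of_ne hv.ne]

/-- The leading monomial here is `y_j ^ (k - d + j)`, for `j` counted from `1`: it belongs to the
complete homogeneous polynomial of this degree in `y_j, …, y_d`. -/
theorem monomial_mem_of_le_y (j : Fin d) {m : Vars n d →₀ ℕ}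
    (hm : k - d + ((j : ℕ) + 1) ≤ m (yv n j)) :
    monomial m (1 : ℚ) ∈ lexInitialIdeal (idealJ n k d) := by
  classical
  set r := k - d + ((j : ℕ) + 1) with hr
  let ι := {l : Fin d // j ≤ l}
  let e : ι → Vars n d := fun l => yv n (l : Fin d)
  have he : Function.Injective e := fun a b h => Subtype.ext (Sum.inr_injective h)
  let F : Poly n d := rename e (hsymm ι ℚ r)
  have hFsum : F = ∑ l ∈ Finset.finsuppAntidiag Finset.univ r, monomial (l.mapDomain e) 1 := by
    simp only [F, hsymm_eq_sum_monomial, map_sum, rename_monomial]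
  have hFJ : F ∈ idealJ n k d := by
    -- `F` is a coefficient of `(∏_{l < j} (1 - y_l T)) * ∑ h_r(y) T ^ r`.
    let y : Fin d → Poly n d := fun l => X (yv n l)
    let E : Polynomial (Poly n d) :=
      ∏ l with ¬ j ≤ l, (1 - Polynomial.C (y l) * Polynomial.X)
    have hE : ePoly y = E * ePoly fun l : ι => y l := by
      rw [ePoly, ePoly, mul_comm, ← Finset.prod_filter_mul_prod_filter_not Finset.univ (j ≤ ·)]
      congr 1
      rw [Finset.prod_subtype _ (p := (j ≤ ·)) (by simp)]
    have hser : (E : PowerSeries (Poly n d)) * hSeries y = hSeries fun l : ι => y l := by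
      have h1 := hSeries_mul_ePoly y
      have h2 := hSeries_mul_ePoly fun l : ι => y l
      rw [hE, Polynomial.coe_mul] at h1
      calc _ = (E : PowerSeries (Poly n d)) * hSeries y *
            ((hSeries fun l : ι => y l) * (ePoly fun l : ι => y l : Polynomial (Poly n d))) := by
              rw [h2, mul_one]
        _ = (hSeries y * ((E : PowerSeries (Poly n d)) *
            (ePoly fun l : ι => y l : Polynomial (Poly n d)))) * hSeries fun l : ι => y l := by
              ring
        _ = _ := by rw [h1, one_mul]
    have hF : F = PowerSeries.coeff r (hSeries fun l : ι => y l) := by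
      rw [hSeries, PowerSeries.coeff_mk]
      exact (aeval_X_left_apply F).symm.trans (aeval_rename _ _ _)
    have hdeg : E.natDegree ≤ j := by
      refine (natDegree_prod_one_sub_le _ _).trans ?_
      simp only [not_le, Finset.filter_gt_eq_Iio, Fin.card_Iio, le_refl]
    rw [hF, ← hser, PowerSeries.coeff_mul]
    refine Ideal.sum_mem _ fun p hp => ?_
    rw [Finset.HasAntidiagonal.mem_antidiagonal] at hp
    by_cases hpj : p.1 ≤ j
    · refine Ideal.mul_mem_left _ _ (Ideal.subset_span (.inl (.inl ⟨p.2, by omega, ?_⟩)))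
      rw [hSeries, PowerSeries.coeff_mk]
      exact (aeval_hy X p.2).symm.trans (aeval_X_left_apply _)
    · rw [Polynomial.coeff_coe, Polynomial.coeff_eq_zero_of_natDegree_lt (by omega), zero_mul]
      exact Ideal.zero_mem _
  have hsupp : ∀ b ∈ F.support, ∃ l : ι →₀ ℕ, l.degree = r ∧ l.mapDomain e = b := by
    intro b hb
    rw [mem_support_iff, hFsum, coeff_sum] at hb
    obtain ⟨l, hl, hlb⟩ := Finset.exists_ne_zero_of_sum_ne_zero hb
    rw [coeff_monomial] at hlb
    refine ⟨l, ?_, by by_contra h; exact hlb (if_neg h)⟩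
    rw [Finset.mem_finsuppAntidiag'] at hl
    exact hl.1
  refine monomial_mem_lexInitialIdeal_of_le hFJ (a := Finsupp.single (yv n j) r) ?_
    (fun b hb => ?_) (Finsupp.single_le_iff.2 hm)
  · have h : Finsupp.single (yv n j) r =
        (Finsupp.single (⟨j, le_rfl⟩ : ι) r).mapDomain e := by
      rw [Finsupp.mapDomain_single]
    rw [h, coeff_rename_mapDomain _ he, hsymm_eq_sum_monomial, coeff_sum]
    simp only [coeff_monomial]
    rw [Finset.sum_ite_eq', if_pos]
    · exact one_ne_zero
    · rw [Finset.mem_finsuppAntidiag']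
      exact ⟨by simp, Finset.subset_univ _⟩
  · obtain ⟨l, hl, rfl⟩ := hsupp b hb
    have h := toLex_le_single (m := l.mapDomain e) (w := yv n j) fun v hv => by
      refine Finsupp.mapDomain_of_notMem_range _ _ ?_
      rintro ⟨a, rfl⟩
      exact absurd (Sum.Lex.inr_lt_inr_iff.1 hv) (not_lt.2 a.2)
    rwa [Finsupp.degree_mapDomain, hl] at h

theorem prod_X_sub_X_mem_idealJ (i : Fin n) :
    ∏ j, (X (xv d i) - X (yv n j)) ∈ idealJ n k d := by
  refine Ideal.subset_span (.inr ⟨i, ?_⟩)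
  rw [prod_sub_eq_sum (X (xv d i) : Poly n d) fun j => X (yv n j), Fintype.card_fin]
  refine Finset.sum_congr rfl fun b _ => ?_
  congr 1
  exact (aeval_ey X b).symm.trans (aeval_X_left_apply _)

theorem monomial_mem_of_le_x (i : Fin n) {m : Vars n d →₀ ℕ} (hm : d ≤ m (xv d i)) :
    monomial m (1 : ℚ) ∈ lexInitialIdeal (idealJ n k d) := by
  have hlt : ∀ j : Fin d, MonomialOrder.lex.toSyn (Finsupp.single (yv n j) 1) <
      MonomialOrder.lex.toSyn (Finsupp.single (xv d i) 1) := fun j => by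
    have hij : xv d i < yv n j := Sum.Lex.inl_lt_inr _ _
    have h : toLex (Finsupp.single (yv n j) 1) < toLex (Finsupp.single (xv d i) 1) :=
      Finsupp.Lex.single_strictAnti hij
    exact h
  have hdeg : ∀ j : Fin d, MonomialOrder.lex.degree (X (xv d i) - X (yv n j) : Poly n d) =
      Finsupp.single (xv d i) 1 := fun j => by
    rw [MonomialOrder.degree_sub_of_lt, MonomialOrder.degree_X]
    rw [MonomialOrder.degree_X, MonomialOrder.degree_X]
    exact hlt j
  have hne : ∀ j : Fin d, (X (xv d i) - X (yv n j) : Poly n d) ≠ 0 := fun j h => by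
    have := hdeg j
    rw [h, MonomialOrder.degree_zero, eq_comm, Finsupp.single_eq_zero] at this
    exact one_ne_zero this
  refine monomial_mem_lexInitialIdeal_iff.2
    ⟨_, prod_X_sub_X_mem_idealJ i, Finset.prod_ne_zero_iff.2 fun j _ => hne j, ?_⟩
  rw [MonomialOrder.degree_prod fun j _ => hne j, Finset.sum_congr rfl fun j _ => hdeg j]
  simpa using hm

/-- Polynomials in `x` with coefficients polynomials in `y`, as polynomials in `x` and `y`. -/
def joinVars (n d : ℕ) : MvPolynomial (Fin n) (MvPolynomial (Fin d) ℚ) →+* Poly n d :=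
  eval₂Hom (rename (yv n) : MvPolynomial (Fin d) ℚ →ₐ[ℚ] Poly n d).toRingHom fun i => X (xv d i)

theorem xv_injective (n d : ℕ) : Function.Injective (xv d : Fin n → Vars n d) :=
  Sum.inl_injective

theorem yv_injective (n d : ℕ) : Function.Injective (yv n : Fin d → Vars n d) :=
  Sum.inr_injective

/-- The exponents of the `x`-variables. -/
def xPart (m : Vars n d →₀ ℕ) : Fin n →₀ ℕ := m.comapDomain (xv d) Sum.inl_injective.injOn

/-- The exponents of the `y`-variables. -/
def yPart (m : Vars n d →₀ ℕ) : Fin d →₀ ℕ := m.comapDomain (yv n) Sum.inr_injective.injOn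

theorem coeff_joinVars (F : MvPolynomial (Fin n) (MvPolynomial (Fin d) ℚ)) (m : Vars n d →₀ ℕ) :
    coeff m (joinVars n d F) = coeff (yPart m) (coeff (xPart m) F) := by
  classical
  induction F using MvPolynomial.induction_on' with
  | add p q hp hq => rw [map_add, coeff_add, hp, hq, coeff_add, coeff_add]
  | monomial a p =>
    induction p using MvPolynomial.induction_on' with
    | add p q hp hq => rw [map_add, map_add, coeff_add, hp, hq, coeff_add, coeff_add]
    | monomial b c =>
      have h : joinVars n d (monomial a (monomial b c)) =
          monomial (b.mapDomain (yv n) + a.mapDomain (xv d)) c := by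
        rw [joinVars, coe_eval₂Hom, eval₂_monomial]
        change rename (yv n) (monomial b c) * _ = _
        rw [rename_monomial]
        have : (a.prod fun i e => (X (xv d i) : Poly n d) ^ e) =
            monomial (a.mapDomain (xv d)) 1 := by
          rw [← rename_monomial, monomial_eq, C_1, one_mul, map_finsuppProd]
          simp
        rw [this, monomial_mul, mul_one]
      have hiff : b.mapDomain (yv n) + a.mapDomain (xv d) = m ↔ a = xPart m ∧ b = yPart m := by
        have hx : ∀ i, (b.mapDomain (yv n) + a.mapDomain (xv d)) (xv d i) = a i := fun i => by
          rw [Finsupp.add_apply, Finsupp.mapDomain_apply (xv_injective n d),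
            Finsupp.mapDomain_of_notMem_range _ _ (by rintro ⟨j, hj⟩; exact Sum.inr_ne_inl hj),
            zero_add]
        have hy : ∀ j, (b.mapDomain (yv n) + a.mapDomain (xv d)) (yv n j) = b j := fun j => by
          rw [Finsupp.add_apply, Finsupp.mapDomain_apply (yv_injective n d),
            Finsupp.mapDomain_of_notMem_range _ _ (by rintro ⟨j, hj⟩; exact Sum.inl_ne_inr hj),
            add_zero]
        constructor
        · rintro rfl
          exact ⟨Finsupp.ext fun i => (hx i).symm, Finsupp.ext fun j => (hy j).symm⟩
        · rintro ⟨ha, hb⟩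
          ext v
          rcases v with i | j
          · exact (hx i).trans (DFunLike.congr_fun ha i)
          · exact (hy j).trans (DFunLike.congr_fun hb j)
      rw [h, coeff_monomial, coeff_monomial]
      by_cases h1 : a = xPart m
      · rw [if_pos h1, coeff_monomial]
        by_cases h2 : b = yPart m
        · rw [if_pos h2, if_pos (hiff.2 ⟨h1, h2⟩)]
        · rw [if_neg h2, if_neg fun h => h2 (hiff.1 h).2]
      · rw [if_neg h1, coeff_zero, if_neg fun h => h1 (hiff.1 h).1]

/-- Modulo `J`, the polynomial `∏ (T - y_j)` divides `∏ (T - x_i)`, so that multiplication by the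
latter modulo the former is zero. -/
theorem joinVars_mem_idealJ (hdn : d ≤ n) {F : MvPolynomial (Fin n) (MvPolynomial (Fin d) ℚ)}
    {f : Polynomial (MvPolynomial (Fin d) ℚ)} (hf : f = ∏ j, (Polynomial.X - Polynomial.C (X j)))
    (hF : F ∈ minorIdeal (f.map C) (∏ i, (Polynomial.C (X i) - Polynomial.X)) 1) :
    joinVars n d F ∈ idealJ n k d := by
  let φ : MvPolynomial (Fin n) (MvPolynomial (Fin d) ℚ) →+* Poly n d ⧸ idealJ n k d :=
    (Ideal.Quotient.mk _).comp (joinVars n d)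
  let z : Vars n d → Poly n d ⧸ idealJ n k d := fun v => Ideal.Quotient.mk _ (X v)
  have hz : ∀ p : Poly n d, aeval z p = Ideal.Quotient.mk (idealJ n k d) p := fun p => by
    have : (aeval z : Poly n d →ₐ[ℚ] _) = Ideal.Quotient.mkₐ ℚ (idealJ n k d) :=
      MvPolynomial.algHom_ext fun v => by simp [z]
    rw [this]
    rfl
  have hφx : ∀ i, φ (X i) = z (xv d i) := fun i => by simp [φ, z, joinVars]
  have hφy : ∀ j, φ (C (X j)) = z (yv n j) := fun j => by simp [φ, z, joinVars]
  have hfm : f.Monic :=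
    hf ▸ Polynomial.monic_prod_of_monic _ _ fun j _ => Polynomial.monic_X_sub_C _
  have h := map_mem_minorIdeal φ (hfm.map C) hF
  have hf' : (f.map C).map φ = ∏ j, (Polynomial.X - Polynomial.C (z (yv n j))) := by
    simp [hf, Polynomial.map_prod, hφy]
  let g : Polynomial (MvPolynomial (Fin n) (MvPolynomial (Fin d) ℚ)) :=
    ∏ i, (Polynomial.C (X i) - Polynomial.X)
  have hg' : g.map φ = ∏ i, (Polynomial.C (z (xv d i)) - Polynomial.X) := by
    simp [g, Polynomial.map_prod, hφx]
  have hdvd : (f.map C).map φ ∣ g.map φ := by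
    rw [hf', hg']
    have h1 := prod_X_sub_C_dvd (fun i => z (xv d i)) (fun j => z (yv n j)) (by simpa using hdn)
      fun r hr => by
        rw [coeff_ePoly_mul_hSeries]
        have h2 : ∑ b ∈ Finset.range (r + 1), (-1) ^ b * ex n d (r - b) * hy n d b ∈
            idealJ n k d :=
          Ideal.subset_span (.inl (.inr ⟨r, by simpa using hr, rfl⟩))
        rw [← Ideal.Quotient.eq_zero_iff_mem, ← hz, map_sum] at h2
        rw [mul_eq_zero_of_right]
        rw [← h2]
        refine Finset.sum_congr rfl fun b _ => ?_
        rw [map_mul, map_mul, aeval_ex, aeval_hy, map_pow, map_neg, map_one]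
    refine h1.trans ?_
    have h3 : ∏ i : Fin n, (Polynomial.C (z (xv d i)) - Polynomial.X) =
        (-1) ^ n * ∏ i : Fin n, (Polynomial.X - Polynomial.C (z (xv d i))) := by
      have h4 : (-1 : Polynomial (Poly n d ⧸ idealJ n k d)) ^ n = ∏ _i : Fin n, (-1) := by simp
      rw [h4, ← Finset.prod_mul_distrib]
      exact Finset.prod_congr rfl fun i _ => by ring
    rw [h3]
    exact Dvd.intro_left _ rfl
  have hbot : minorIdeal ((f.map C).map φ) (g.map φ) 1 ≤ ⊥ := by
    refine Ideal.span_le.2 ?_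
    rintro _ ⟨q, r, rfl⟩
    rw [Matrix.det_fin_one, Matrix.of_apply,
      (Polynomial.modByMonic_eq_zero_iff_dvd ((hfm.map C).map φ)).2 (hdvd.mul_right _)]
    simp
  exact Ideal.Quotient.eq_zero_iff_mem.1 ((Submodule.mem_bot _).1 (hbot h))

theorem monomial_mem_of_greedyFails (hdn : d ≤ n) {m : Vars n d →₀ ℕ}
    (hm : GreedyFails d 1 fun i => m (xv d i)) :
    monomial m (1 : ℚ) ∈ lexInitialIdeal (idealJ n k d) := by
  classical
  let f : Polynomial (MvPolynomial (Fin d) ℚ) := ∏ j, (Polynomial.X - Polynomial.C (X j))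
  have hfm : f.Monic := Polynomial.monic_prod_of_monic _ _ fun j _ => Polynomial.monic_X_sub_C _
  have hfd : f.natDegree = d := by simp [f]
  have hm' : GreedyFails f.natDegree 1 fun i => m (xv d i) := by rwa [hfd]
  obtain ⟨F, hF, ha, hlead⟩ := exists_mem_minorIdeal_hasLexLead hfm 1 _ hm'
  set a : Fin n →₀ ℕ := Finsupp.equivFunOnFinite.symm fun i => m (xv d i) with ha_def
  let a' : Vars n d →₀ ℕ := a.mapDomain (xv d)
  have hax : ∀ i, a' (xv d i) = a i := fun i => Finsupp.mapDomain_apply (xv_injective n d) _ _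
  have hay : ∀ j, a' (yv n j) = 0 := fun j =>
    Finsupp.mapDomain_of_notMem_range _ _ (by rintro ⟨i, hi⟩; exact Sum.inl_ne_inr hi)
  have hx : xPart a' = a := Finsupp.ext hax
  have hy : yPart a' = 0 := Finsupp.ext hay
  refine monomial_mem_lexInitialIdeal_of_le (joinVars_mem_idealJ hdn rfl hF) (a := a') ?_
    (fun b hb => ?_) fun v => ?_
  · rw [coeff_joinVars, hx, hy, ha]
    simp
  · rw [mem_support_iff, coeff_joinVars] at hb
    have hbx : xPart b ∈ F.support := mem_support_iff.2 fun h => hb (by rw [h, coeff_zero])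
    rcases (hlead _ hbx).eq_or_lt with h | h
    · have h1 : xPart b = a := toLex.injective h
      rw [h1, ha, coeff_one] at hb
      have h2 : yPart b = 0 := by
        by_contra h2
        exact hb (if_neg (Ne.symm h2))
      refine le_of_eq (congrArg toLex (Finsupp.ext fun v => ?_))
      rcases v with i | j
      · exact (DFunLike.congr_fun h1 i).trans (hax i).symm
      · exact (DFunLike.congr_fun h2 j).trans (hay j).symm
    · rw [Finsupp.Lex.lt_iff] at h
      obtain ⟨i, hi, hlt⟩ := h
      refine le_of_lt (Finsupp.Lex.lt_iff.2 ⟨xv d i, fun v hv => ?_, ?_⟩)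
      · rcases v with l | j
        · exact (hi l (Sum.Lex.inl_lt_inl_iff.1 hv)).trans (hax l).symm
        · exact absurd hv (not_lt.2 (Sum.Lex.inl_lt_inr i j).le)
      · exact hlt.trans_eq (hax i).symm
  · rcases v with i | j
    · exact (hax i).trans_le le_rfl
    · exact (hay j).trans_le (Nat.zero_le _)

theorem monomial_mem_of_notMem_setA (hd : 0 < d) (hdn : d ≤ n) {m : Vars n d →₀ ℕ}
    (hm : m ∉ setA n k d) : monomial m (1 : ℚ) ∈ lexInitialIdeal (idealJ n k d) := by
  by_cases hy : ∀ j : Fin d, m (yv n j) < k - d + ((j : ℕ) + 1)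
  · have hx : ¬ IsSubstaircase d fun i : Fin n => m (xv d i) := fun h => hm ⟨h, hy⟩
    rw [isSubstaircase_iff hd hdn, not_and_or, not_not] at hx
    rcases hx with hx | hx
    · exact monomial_mem_of_greedyFails hdn hx
    · push Not at hx
      obtain ⟨i, hi⟩ := hx
      exact monomial_mem_of_le_x i hi
  · push Not at hy
    obtain ⟨j, hj⟩ := hy
    exact monomial_mem_of_le_y j hj

end UpperBound

/-! ### Comparison of cardinalities -/

section Conclusion

variable {n k d : ℕ}

theorem finite_locus (n d : ℕ) (α : Fin k → ℚ) : (locus n d α).Finite :=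
  (Set.Finite.pi' fun _ : Vars n d => Set.finite_range α).subset fun _ hz => hz.1

open scoped Classical in
/-- A point of the locus is a surjection `Fin n → Fin d` together with an injective choice of
values `Fin d ↪ Fin k`. -/
theorem card_mul_card_le_ncard_locus {α : Fin k → ℚ} (hα : Function.Injective α) :
    Fintype.card {w : Fin n → Fin d // Function.Surjective w} * Fintype.card (Fin d ↪ Fin k) ≤
      (locus n d α).ncard := by
  let F : {w : Fin n → Fin d // Function.Surjective w} × (Fin d ↪ Fin k) → locus n d α :=
    fun p => ⟨fun v => Sum.elim (fun i => α (p.2 (p.1.1 i))) (fun j => α (p.2 j)) (ofLex v), by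
      refine ⟨fun v => ?_, fun a b h => p.2.injective (hα h), ?_⟩
      · rcases v with i | j
        · exact ⟨_, rfl⟩
        · exact ⟨_, rfl⟩
      · exact p.1.2.range_comp fun j => α (p.2 j)⟩
  have hF : Function.Injective F := by
    rintro ⟨⟨w, hw⟩, e⟩ ⟨⟨w', hw'⟩, e'⟩ h
    have h' := fun v => congrFun (congrArg Subtype.val h) v
    have he : e = e' := DFunLike.ext _ _ fun j => hα (h' (yv n j))
    subst he
    have hww : w = w' := funext fun i => e.injective (hα (h' (xv d i)))
    subst hww
    rfl
  have := (finite_locus n d α).to_subtype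
  have h := Nat.card_le_card_of_injective F hF
  rwa [Nat.card_prod, Nat.card_eq_fintype_card, Nat.card_eq_fintype_card,
    Nat.card_coe_set_eq] at h

theorem prod_add_eq_card_embedding (hdk : d ≤ k) :
    ∏ j : Fin d, (k - d + ((j : ℕ) + 1)) = Fintype.card (Fin d ↪ Fin k) := by
  rw [Fintype.card_embedding_eq, Fintype.card_fin, Fintype.card_fin,
    Nat.descFactorial_eq_prod_range, Fin.prod_univ_eq_prod_range (fun j => k - d + (j + 1)),
    ← Finset.prod_range_reflect]
  refine Finset.prod_congr rfl fun j hj => ?_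
  have := Finset.mem_range.1 hj
  omega

open scoped Classical in
theorem finite_setA_and_ncard_le (hd : 0 < d) (hdk : d ≤ k) (hdn : d ≤ n) :
    (setA n k d).Finite ∧ (setA n k d).ncard ≤
      Fintype.card {w : Fin n → Fin d // Function.Surjective w} * Fintype.card (Fin d ↪ Fin k) := by
  let T := {a : Fin n → Fin d // ¬ GreedyFails d 1 fun i => (a i : ℕ)} ×
    ((j : Fin d) → Fin (k - d + ((j : ℕ) + 1)))
  have hA : ∀ m : setA n k d, (¬ GreedyFails d 1 fun i : Fin n => m.1 (xv d i)) ∧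
      ∀ i : Fin n, m.1 (xv d i) < d := fun m => (isSubstaircase_iff hd hdn _).1 m.2.1
  let F : setA n k d → T := fun m =>
    (⟨fun i => ⟨m.1 (xv d i), (hA m).2 i⟩, (hA m).1⟩, fun j => ⟨m.1 (yv n j), m.2.2 j⟩)
  have hF : Function.Injective F := by
    intro m m' h
    refine Subtype.ext (Finsupp.ext fun v => ?_)
    rcases v with i | j
    · exact congrArg Fin.val (congrFun (congrArg Subtype.val (congrArg Prod.fst h)) i)
    · exact congrArg Fin.val (congrFun (congrArg Prod.snd h) j)
  have hfin : Finite (setA n k d) := Finite.of_injective F hF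
  refine ⟨Set.toFinite _, ?_⟩
  have h := Nat.card_le_card_of_injective F hF
  have hsurj : ∀ w : Fin n → Fin d,
      d + 1 - 1 ≤ (Finset.univ.image w).card ↔ Function.Surjective w := fun w => by
    have hw : Function.Surjective w ↔ Finset.univ.image w = Finset.univ := by
      simp [Finset.eq_univ_iff_forall, Function.Surjective]
    rw [hw, ← Finset.card_eq_iff_eq_univ, Fintype.card_fin, Nat.add_sub_cancel]
    have := (Finset.card_le_univ (Finset.univ.image w)).trans_eq (Fintype.card_fin d)
    omega
  have hcount := card_not_greedyFails d n 1 le_rfl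
  simp only [hsurj] at hcount
  rw [← Fintype.card_subtype, ← Fintype.card_subtype] at hcount
  rw [Nat.card_coe_set_eq, Nat.card_prod, Nat.card_eq_fintype_card, Nat.card_eq_fintype_card,
    Fintype.card_pi, hcount] at h
  simpa only [Fintype.card_fin, prod_add_eq_card_embedding hdk] using h

end Conclusion

end

end OrbitHarmonics

theorem mainTheorem4 (n k d : ℕ) (hd : 0 < d) (hdk : d ≤ k) (hkn : k ≤ n)
    (α : Fin k → ℚ) (hα : Function.Injective α) :
    OrbitHarmonics.grIdeal (MvPolynomial.vanishingIdeal ℚ (OrbitHarmonics.locus n d α)) =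
        OrbitHarmonics.idealJ n k d ∧
      Nonempty (Representation.Equiv (OrbitHarmonics.coordRingRep n d α)
        (OrbitHarmonics.grQuotientRep n d α)) ∧
      OrbitHarmonics.IsLexStandardMonomialBasis
        (OrbitHarmonics.grIdeal (MvPolynomial.vanishingIdeal ℚ (OrbitHarmonics.locus n d α)))
        (OrbitHarmonics.setA n k d) := by
  open OrbitHarmonics MvPolynomial in
  have hdn : d ≤ n := hdk.trans hkn
  obtain ⟨π₀, hπ₀⟩ := exists_isGradedProjection (vanishingIdeal ℚ (locus n d α))
  obtain ⟨π, hπ, hequiv⟩ := hπ₀.exists_equivariant (polyRep n d)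
    (fun w _ hf => grIdeal_rename_mem (permVars n w) (permVars_injective n w)
      (rename_mem_vanishingIdeal n d α w) hf)
    (fun w m f hf => hf.rename_isHomogeneous)
  obtain ⟨e, he⟩ := hπ.exists_linearEquiv
  obtain ⟨hfin, hcard⟩ := finite_setA_and_ncard_le hd hdk hdn
  have hdim : Module.finrank ℚ (Poly n d ⧸ grIdeal (vanishingIdeal ℚ (locus n d α))) =
      (locus n d α).ncard := by
    rw [← finrank_quotient_vanishingIdeal (finite_locus n d α), ← e.finrank_eq]
    exact (Submodule.Quotient.restrictScalarsEquiv ℚ _).finrank_eq.symm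
  obtain ⟨hJ, hbasis⟩ := eq_and_isLexStandardMonomialBasis (idealJ_le_grIdeal α) hfin
    (fun m hm => monomial_mem_of_notMem_setA hd hdn hm)
    (hdim ▸ hcard.trans (card_mul_card_le_ncard_locus hα))
  refine ⟨hJ, ⟨Representation.Equiv.symm (Representation.Equiv.mk e fun w => ?_)⟩, hbasis⟩
  refine LinearMap.ext fun x => ?_
  obtain ⟨f, rfl⟩ := Submodule.Quotient.mk_surjective _ x
  have h1 : e (grQuotientRep n d α w (Submodule.Quotient.mk f)) =
      Submodule.Quotient.mk (polyRep n d w f - π (polyRep n d w f)) := he _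
  have h2 : coordRingRep n d α w (e (Submodule.Quotient.mk f)) =
      Submodule.Quotient.mk (polyRep n d w (f - π f)) := by
    rw [he]
    rfl
  rw [hequiv, ← map_sub, ← h2] at h1
  exact h1
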